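/- Let $k$ be a field of characteristic $0$ (hence infinite) whose only field automorphism is the identity. A representation $H=(L,V)$ consists of a Lie algebra $L$ over $k$ and a $k$-vector space $V$ on which $L$ acts by a Lie algebra homomorphism $L\to \mathfrak{gl}_k(V)$, $l\mapsto(v\mapsto l\circ v)$. A homomorphism $(\varphi,\psi):(L,V)\to(L',V')$ consists of a Lie algebra homomorphism $\varphi:L\to L'$ and a $k$-linear map $\psi:V\to V'$ with $\varphi(l)\circ\psi(v)=\psi(l\circ v)$ for all $l\in L$, $v\in V$. Fix countably infinite sets $X^0,Y^0$. For finite subsets $X\subset X^0$, $Y\subset Y^0$ let $W(X,Y)=(L(X),A(X)Y)$, where $L(X)$ is the free Lie algebra on $X$ over $k$, $A(X)$ is the free associative unital $k$-algebra on $X$, $A(X)Y=\bigoplus_{y\in Y}A(X)y$ is the free left $A(X)$-module with basis $Y$, and $L(X)$ acts through the canonical map $L(X)\to A(X)$. Let $\Xi^0$ be the category whose objects are all these $W(X,Y)$ and whose morphisms are all homomorphisms of representations between them. For $W=W(X,Y)$, a representation $H$ and a pair of subsets $T=(T_1,T_2)$, $T_1\subseteq L(X)$, $T_2\subseteq A(X)Y$,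 let $$T'_H=\{(\varphi,\psi)\in\mathrm{Hom}(W,H)\mid T_1\subseteq\ker\varphi,\ T_2\subseteq\ker\psi\},\qquad T''_H=\Bigl(\bigcap_{(\varphi,\psi)\in T'_H}\ker\varphi,\ \bigcap_{(\varphi,\psi)\in T'_H}\ker\psi\Bigr).$$ Call $T$ $H$-closed if $T''_H=T$, and let $Cl_H(W)$ be the set of $H$-closed pairs in $W$. For $W_1,W_2\in\mathrm{Ob}\,\Xi^0$ and a closed pair $T=(T_1,T_2)$ in $W_2$, let $\beta_{W_1,W_2}(T)$ be the set of pairs $((\varphi_1,\psi_1),(\varphi_2,\psi_2))$ of homomorphisms $W_1\to W_2$ such that $\varphi_1(l)-\varphi_2(l)\in T_1$ and $\psi_1(v)-\psi_2(v)\in T_2$ for all $l$ in the Lie algebra of $W_1$ and all $v$ in the module of $W_1$. Representations $H_1,H_2$ are geometrically equivalent if $T''_{H_1}=T''_{H_2}$ for every $W\in\mathrm{Ob}\,\Xi^0$ and every pair of subsets $T$ of $W$. They are automorphically equivalent if there are an automorphism $\Phi$ of the category $\Xi^0$ and bijections $\alpha_W:Cl_{H_1}(W)\to Cl_{H_2}(\Phi(W))$,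 one for each $W\in\mathrm{Ob}\,\Xi^0$, such that $\Phi(\beta_{W_1,W_2}(T))=\beta_{\Phi(W_1),\Phi(W_2)}(\alpha_{W_2}(T))$ for all $W_1,W_2\in\mathrm{Ob}\,\Xi^0$ and all $T\in Cl_{H_1}(W_2)$, where $\Phi$ is applied to both members of each pair of morphisms. Theorem. Two representations $H_1,H_2$ of Lie algebras over $k$ are automorphically equivalent if and only if they are geometrically equivalent. -/

import Mathlib

universe u a b v w v' w'

/-- A homomorphism `(φ, ψ) : (L, V) → (L', V')` of representations of Lie algebras over `k`: a
homomorphism of Lie algebras `φ` and a `k`-linear map `ψ` with `φ(l) ∘ ψ(v) = ψ(l ∘ v)`. -/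
@[ext]
structure LieRepHom (k : Type u) [CommRing k]
    (L : Type v) (V : Type w) (L' : Type v') (V' : Type w')
    [LieRing L] [LieAlgebra k L] [AddCommGroup V] [Module k V] [LieRingModule L V]
    [LieModule k L V]
    [LieRing L'] [LieAlgebra k L'] [AddCommGroup V'] [Module k V'] [LieRingModule L' V']
    [LieModule k L' V'] where
  /-- The component on the Lie algebras. -/
  lie : L →ₗ⁅k⁆ L'
  /-- The component on the modules. -/
  mod : V →ₗ[k] V'
  /-- Compatibility with the actions. -/
  map_act : ∀ (l : L) (x : V), ⁅lie l, mod x⁆ = mod ⁅l, x⁆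

/-- The free module `A(X)Y = ⨁_{y ∈ Y} A(X) y` with basis `Y` over the free associative unital
algebra `A(X)`. -/
abbrev FreeActModule (k : Type u) [CommRing k] (X : Type a) (Y : Type b) : Type (max u a b) :=
  Y →₀ FreeAlgebra k X

section FreeAction

attribute [local instance] LieRing.ofAssociativeRing LieAlgebra.ofAssociativeAlgebra

/-- The linear map underlying the canonical homomorphism from the free Lie algebra `L(X)` to the free associative unital
algebra `A(X)` with the commutator bracket, identical on the generators. -/
noncomputable def freeLieToFreeAssoc (k : Type u) [CommRing k] (X : Type a) :
    FreeLieAlgebra k X →ₗ[k] FreeAlgebra k X :=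
  (FreeLieAlgebra.lift k (FreeAlgebra.ι k (X := X))).toLinearMap

theorem freeLieToFreeAssoc_of (k : Type u) [CommRing k] (X : Type a) (x : X) :
    freeLieToFreeAssoc k X (FreeLieAlgebra.of k x) = FreeAlgebra.ι k x :=
  FreeLieAlgebra.lift_of_apply (R := k) (FreeAlgebra.ι k (X := X)) x

theorem freeLieToFreeAssoc_lie (k : Type u) [CommRing k] (X : Type a) (l m : FreeLieAlgebra k X) :
    freeLieToFreeAssoc k X ⁅l, m⁆ =
      freeLieToFreeAssoc k X l * freeLieToFreeAssoc k X m -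
        freeLieToFreeAssoc k X m * freeLieToFreeAssoc k X l :=
  (FreeLieAlgebra.lift k (FreeAlgebra.ι k (X := X))).map_lie l m

end FreeAction

/-- `L(X)` acts on `A(X)Y` through `L(X) → A(X)` and the left multiplication. -/
noncomputable instance FreeActModule.instLieRingModule (k : Type u) [CommRing k]
    (X : Type a) (Y : Type b) : LieRingModule (FreeLieAlgebra k X) (FreeActModule k X Y) where
  bracket l x := freeLieToFreeAssoc k X l • x
  add_lie l m x := by
    change freeLieToFreeAssoc k X (l + m) • x = _
    rw [map_add, add_smul]
  lie_add l x y := smul_add _ x y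
  leibniz_lie l m x := by
    change freeLieToFreeAssoc k X l • freeLieToFreeAssoc k X m • x =
      freeLieToFreeAssoc k X ⁅l, m⁆ • x +
        freeLieToFreeAssoc k X m • freeLieToFreeAssoc k X l • x
    rw [freeLieToFreeAssoc_lie, sub_smul, mul_smul, mul_smul, sub_add_cancel]

instance FreeActModule.instLieModule (k : Type u) [CommRing k] (X : Type a) (Y : Type b) :
    LieModule k (FreeLieAlgebra k X) (FreeActModule k X Y) where
  smul_lie t l x := by
    change freeLieToFreeAssoc k X (t • l) • x = t • freeLieToFreeAssoc k X l • x
    rw [map_smul, smul_assoc]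
  lie_smul t l x := by
    change freeLieToFreeAssoc k X l • t • x = t • freeLieToFreeAssoc k X l • x
    ext y
    simp

/-- The objects of the category `Ξ⁰`: the free representations `W(X, Y) = (L(X), A(X)Y)` with
finite sets of generators `X ⊂ X₀`, `Y ⊂ Y₀`. -/
@[ext]
structure FreeRep (k : Type u) (X₀ : Type a) (Y₀ : Type b) where
  /-- The free generators of the Lie algebra. -/
  X : Finset X₀
  /-- The free generators of the module. -/
  Y : Finset Y₀

namespace FreeRep

/-- The Lie algebra `L(X)` of `W(X, Y)`. -/
abbrev Lie {k : Type u} [CommRing k] {X₀ : Type a} {Y₀ : Type b} (W : FreeRep k X₀ Y₀) :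
    Type (max u a) :=
  FreeLieAlgebra k W.X

/-- The module `A(X)Y` of `W(X, Y)`. -/
abbrev Mod {k : Type u} [CommRing k] {X₀ : Type a} {Y₀ : Type b} (W : FreeRep k X₀ Y₀) :
    Type (max u a b) :=
  FreeActModule k W.X W.Y

/-- The category `Ξ⁰`: its morphisms are all homomorphisms of representations. -/
noncomputable instance instCategory (k : Type u) [CommRing k] (X₀ : Type a) (Y₀ : Type b) :
    CategoryTheory.Category (FreeRep k X₀ Y₀) where
  Hom W₁ W₂ := LieRepHom k W₁.Lie W₁.Mod W₂.Lie W₂.Mod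
  id W := ⟨LieHom.id, LinearMap.id, fun _ _ => rfl⟩
  comp f g := ⟨g.lie.comp f.lie, g.mod ∘ₗ f.mod, fun l x => by
    change ⁅g.lie (f.lie l), g.mod (f.mod x)⁆ = g.mod (f.mod ⁅l, x⁆)
    rw [g.map_act, f.map_act]⟩

end FreeRep

/-- Systems of equations `(T₁, T₂) ⊆ W(X, Y)`. -/
abbrev EqSystem {k : Type u} [CommRing k] {X₀ : Type a} {Y₀ : Type b} (W : FreeRep k X₀ Y₀) :
    Type (max u a b) :=
  Set W.Lie × Set W.Mod

section Galois

variable {k : Type u} [CommRing k] {X₀ : Type a} {Y₀ : Type b} {W : FreeRep k X₀ Y₀}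
variable (L : Type v) (V : Type w) [LieRing L] [LieAlgebra k L] [AddCommGroup V] [Module k V]
  [LieRingModule L V] [LieModule k L V]

/-- The set `(T₁, T₂)'_H` of solutions of the system `(T₁, T₂)` in `H = (L, V)`. -/
def solutions (T : EqSystem W) : Set (LieRepHom k W.Lie W.Mod L V) :=
  {f | (∀ t ∈ T.1, f.lie t = 0) ∧ ∀ t ∈ T.2, f.mod t = 0}

variable {L V} in
/-- The system `A'_H = (⋂ ker φ, ⋂ ker ψ)`, `(φ, ψ)` running over `A ⊆ Hom(W, H)`. -/
def equationsOf (A : Set (LieRepHom k W.Lie W.Mod L V)) : EqSystem W :=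
  ({t | ∀ f ∈ A, f.lie t = 0}, {t | ∀ f ∈ A, f.mod t = 0})

/-- The algebraic closure `(T₁, T₂)''_H`. -/
def algClosure (T : EqSystem W) : EqSystem W :=
  equationsOf (solutions L V T)

variable (W) in
/-- The family `Cl_H(W)` of all `H`-closed systems in `W`. -/
def closedSystems : Set (EqSystem W) :=
  {T | algClosure L V T = T}

end Galois

/-- The relation `β_{W₁,W₂}(T₁, T₂)` in `Hom(W₁, W₂)`: the pairs of homomorphisms that are
congruent modulo `(T₁, T₂)`. -/
def congrRel {k : Type u} [CommRing k] {X₀ : Type a} {Y₀ : Type b} (W₁ W₂ : FreeRep k X₀ Y₀)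
    (T : EqSystem W₂) : Set ((W₁ ⟶ W₂) × (W₁ ⟶ W₂)) :=
  {p | (∀ l : W₁.Lie, p.1.lie l - p.2.lie l ∈ T.1) ∧ ∀ x : W₁.Mod, p.1.mod x - p.2.mod x ∈ T.2}

/-- An automorphism of a category: a functor with a two-sided strict inverse. -/
def IsCategoryAut {C : Type a} [CategoryTheory.Category.{b} C] (Φ : CategoryTheory.Functor C C) :
    Prop :=
  ∃ Ψ : CategoryTheory.Functor C C,
    Φ.comp Ψ = CategoryTheory.Functor.id C ∧ Ψ.comp Φ = CategoryTheory.Functor.id C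

section Equivalences

variable (k : Type u) [CommRing k] (X₀ : Type a) (Y₀ : Type b)
variable (L₁ : Type v) (V₁ : Type w) [LieRing L₁] [LieAlgebra k L₁] [AddCommGroup V₁] [Module k V₁]
  [LieRingModule L₁ V₁] [LieModule k L₁ V₁]
variable (L₂ : Type v') (V₂ : Type w') [LieRing L₂] [LieAlgebra k L₂] [AddCommGroup V₂]
  [Module k V₂] [LieRingModule L₂ V₂] [LieModule k L₂ V₂]

/-- Geometric equivalence of `(L₁, V₁)` and `(L₂, V₂)`. -/
def GeometricallyEquivalent : Prop :=
  ∀ (W : FreeRep k X₀ Y₀) (T : EqSystem W), algClosure L₁ V₁ T = algClosure L₂ V₂ T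

/-- Automorphic equivalence of `(L₁, V₁)` and `(L₂, V₂)`. -/
def AutomorphicallyEquivalent : Prop :=
  ∃ Φ : CategoryTheory.Functor (FreeRep k X₀ Y₀) (FreeRep k X₀ Y₀), IsCategoryAut Φ ∧
    ∃ α : ∀ W : FreeRep k X₀ Y₀, closedSystems W L₁ V₁ → closedSystems (Φ.obj W) L₂ V₂,
      (∀ W, Function.Bijective (α W)) ∧
      ∀ (W₁ W₂ : FreeRep k X₀ Y₀) (T : closedSystems W₂ L₁ V₁),
        (fun p : (W₁ ⟶ W₂) × (W₁ ⟶ W₂) => (Φ.map p.1, Φ.map p.2)) '' congrRel W₁ W₂ T.1 =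
          congrRel (Φ.obj W₁) (Φ.obj W₂) (α W₂ T).1

end Equivalences

/-! Geometric equivalence gives automorphic equivalence through the identity functor. For the
converse, let `Φ` be the automorphism.

The free representations on one Lie generator and on one module generator represent the functors
sending `W` to its Lie algebra and to its module. Among all objects they are exactly those whose
endomorphism monoid has two idempotents (`HasTwoIdempotents.isLieGen_or_isModGen`), and `Φ` cannot
exchange the two kinds (`not_isModGen_and_isLieGen_map`). Hence `Φ` acts on elements: there are
natural bijections `s` from the Lie algebra and the module of `W` to those of `Φ.obj W`
(`ElementMaps`).

Pulling the operations of `Φ.obj W` back along `s` gives natural operations on free representations.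
Such an operation is determined by its value on free generators, and a grading argument leaves few
possibilities. Addition pulls back to addition; scalar multiplication pulls back through a field
automorphism of `k`, which is the identity; the bracket and the action pull back to multiples of
themselves. The Leibniz identity makes the two factors equal, and rescaling `s` on the Lie algebras
turns it into isomorphisms of representations `F : W ⟶ Φ.obj W` (`exists_lieRepHom`).

Applied to morphisms out of the one-generator objects, the condition on the congruences says that `α
W` carries `T` to its image under `s`; closed pairs are stable under scalars, so this is the image
under `F`. Closedness passes to inverse images under morphisms, so both representations have the
same closed pairs, and a closure operator is determined by its closed elements. -/

open CategoryTheory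

/-! ### Monomials and the grading of the free Lie algebra. -/

section FreeLie

variable {k : Type u} [CommRing k] {X : Type a}

/-- The generators lift to a homomorphism into `K`, and its composite with the inclusion fixes the
generators, so it is the identity. This serves as the induction principle for free Lie algebras. -/
theorem FreeLieAlgebra.mem_of_forall_of_mem (K : LieSubalgebra k (FreeLieAlgebra k X))
    (hK : ∀ x, FreeLieAlgebra.of k x ∈ K) (l : FreeLieAlgebra k X) : l ∈ K := by
  let g : FreeLieAlgebra k X →ₗ⁅k⁆ K := FreeLieAlgebra.lift k fun x => ⟨FreeLieAlgebra.of k x, hK x⟩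
  have h : K.incl.comp g = LieHom.id := by
    apply FreeLieAlgebra.hom_ext
    intro x
    simp [g, FreeLieAlgebra.lift_of_apply]
  have h' := congrArg (fun f => f l) h
  change (g l : FreeLieAlgebra k X) = l at h'
  rw [← h']
  exact (g l).2

theorem FreeLieAlgebra.of_ne_zero [Nontrivial k] (x : X) : FreeLieAlgebra.of k x ≠ 0 := by
  intro h
  have := freeLieToFreeAssoc_of k X x
  rw [h, map_zero] at this
  exact FreeAlgebra.ι_ne_zero x this.symm

/-- The monomials of degree `n` in the free Lie algebra. -/
inductive FreeLieAlgebra.IsMonomial : ℕ → FreeLieAlgebra k X → Prop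
  | of (x : X) : IsMonomial 1 (FreeLieAlgebra.of k x)
  | lie {i j : ℕ} {l m : FreeLieAlgebra k X} :
      IsMonomial i l → IsMonomial j m → IsMonomial (i + j) ⁅l, m⁆

namespace FreeLieAlgebra.IsMonomial

theorem pos {n : ℕ} {l : FreeLieAlgebra k X} (h : IsMonomial n l) : 0 < n := by
  induction h with
  | of x => exact Nat.one_pos
  | lie _ _ h _ => omega

theorem eq_of {l : FreeLieAlgebra k X} (h : IsMonomial 1 l) : ∃ x, l = FreeLieAlgebra.of k x := by
  generalize hn : 1 = n at h
  cases h with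
  | of x => exact ⟨x, rfl⟩
  | lie h₁ h₂ =>
    have := h₁.pos
    have := h₂.pos
    omega

theorem eq_lie_of {l : FreeLieAlgebra k X} (h : IsMonomial 2 l) :
    ∃ x y : X, l = ⁅FreeLieAlgebra.of k x, FreeLieAlgebra.of k y⁆ := by
  generalize hn : 2 = n at h
  cases h with
  | of x => omega
  | @lie i j _ _ h₁ h₂ =>
    have := h₁.pos
    have := h₂.pos
    obtain rfl : i = 1 := by omega
    obtain rfl : j = 1 := by omega
    obtain ⟨x, rfl⟩ := h₁.eq_of
    obtain ⟨y, rfl⟩ := h₂.eq_of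
    exact ⟨x, y, rfl⟩

theorem map_eq {n : ℕ} {l : FreeLieAlgebra k X} (h : IsMonomial n l) {c : k}
    (f : FreeLieAlgebra k X →ₗ⁅k⁆ FreeLieAlgebra k X)
    (hf : ∀ x, f (FreeLieAlgebra.of k x) = c • FreeLieAlgebra.of k x) : f l = c ^ n • l := by
  induction h with
  | of x => rw [hf, pow_one]
  | lie _ _ h₁ h₂ => rw [LieHom.map_lie, h₁, h₂, smul_lie, lie_smul, smul_smul, pow_add]

theorem iSup_span_eq_top :
    ⨆ n, Submodule.span k {l : FreeLieAlgebra k X | IsMonomial n l} = ⊤ := by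
  rw [← Submodule.span_iUnion]
  set S : Set (FreeLieAlgebra k X) := ⋃ n, {l | IsMonomial n l} with hS
  have hlie : ∀ l ∈ Submodule.span k S, ∀ m ∈ Submodule.span k S, ⁅l, m⁆ ∈ Submodule.span k S := by
    intro l hl m hm
    induction hl, hm using Submodule.span_induction₂ with
    | mem_mem l m hl hm =>
      obtain ⟨i, hi⟩ := Set.mem_iUnion.1 hl
      obtain ⟨j, hj⟩ := Set.mem_iUnion.1 hm
      exact Submodule.subset_span (Set.mem_iUnion.2 ⟨i + j, hi.lie hj⟩)
    | zero_left m _ => simp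
    | zero_right l _ => simp
    | add_left _ _ _ _ _ _ h₁ h₂ => rw [add_lie]; exact add_mem h₁ h₂
    | add_right _ _ _ _ _ _ h₁ h₂ => rw [lie_add]; exact add_mem h₁ h₂
    | smul_left c _ _ _ _ h => rw [smul_lie]; exact Submodule.smul_mem _ c h
    | smul_right c _ _ _ _ h => rw [lie_smul]; exact Submodule.smul_mem _ c h
  rw [eq_top_iff]
  intro l _
  exact FreeLieAlgebra.mem_of_forall_of_mem
    { Submodule.span k S with lie_mem' := fun {l m} hl hm => hlie l hl m hm }
    (fun x => Submodule.subset_span (Set.mem_iUnion.2 ⟨1, .of x⟩)) l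

end FreeLieAlgebra.IsMonomial

theorem FreeLieAlgebra.exists_smul_of [Unique X] (l : FreeLieAlgebra k X) :
    ∃ c : k, l = c • FreeLieAlgebra.of k default := by
  have h := FreeLieAlgebra.mem_of_forall_of_mem
    { Submodule.span k {FreeLieAlgebra.of k (default : X)} with
      lie_mem' := fun {l m} hl hm => by
        obtain ⟨c, rfl⟩ := Submodule.mem_span_singleton.1 hl
        obtain ⟨d, rfl⟩ := Submodule.mem_span_singleton.1 hm
        simp } (fun x => by
          rw [Unique.eq_default x]
          exact Submodule.subset_span rfl) l
  obtain ⟨c, hc⟩ := Submodule.mem_span_singleton.1 h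
  exact ⟨c, hc.symm⟩

theorem FreeLieAlgebra.eq_zero_of_isEmpty [IsEmpty X] (l : FreeLieAlgebra k X) : l = 0 :=
  (LieSubalgebra.mem_bot l).1 (FreeLieAlgebra.mem_of_forall_of_mem ⊥ isEmptyElim l)

end FreeLie

/-! ### Homogeneous components as eigenspaces. -/

section Homogeneous

variable {k : Type u} [Field k] [CharZero k]

/-- An eigenvector of eigenvalue `2 ^ d` of a grading operator is homogeneous of degree `d`. -/
theorem mem_of_graded_eigenvector {M : Type v} [AddCommGroup M] [Module k M] (D : Module.End k M)
    (G : ℕ → Submodule k M) (hG : ⨆ n, G n = ⊤) (hD : ∀ n, ∀ x ∈ G n, D x = (2 : k) ^ n • x)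
    {d : ℕ} {x : M} (hx : D x = (2 : k) ^ d • x) : x ∈ G d := by
  have hinj : Function.Injective fun n : ℕ => (2 : k) ^ n := by
    intro m n h
    have h' : ((2 ^ m : ℕ) : k) = ((2 ^ n : ℕ) : k) := by simpa using h
    exact Nat.pow_right_injective le_rfl (Nat.cast_injective h')
  have hle : ∀ n, G n ≤ D.eigenspace ((2 : k) ^ n) := fun n x hx =>
    Module.End.mem_eigenspace_iff.2 (hD n x hx)
  have hind := (Module.End.eigenspaces_iSupIndep D).comp hinj d
  have htop : x ∈ G d ⊔ ⨆ (j) (_ : j ≠ d), G j := by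
    have : G d ⊔ ⨆ (j) (_ : j ≠ d), G j = ⊤ := by
      rw [eq_top_iff, ← hG]
      refine iSup_le fun n => ?_
      by_cases h : n = d
      · subst h
        exact le_sup_left
      · exact le_sup_of_le_right (le_iSup₂_of_le n h le_rfl)
    rw [this]
    trivial
  -- The part `z` of `x` outside degree `d` is again an eigenvector for `2 ^ d`, yet it lies in the
  -- sum of the other eigenspaces; independence gives `z = 0`.
  obtain ⟨y, hy, z, hz, rfl⟩ := Submodule.mem_sup.1 htop
  have hz₁ : z ∈ D.eigenspace ((2 : k) ^ d) := by
    rw [Module.End.mem_eigenspace_iff]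
    rw [map_add, hD d y hy, smul_add] at hx
    exact add_left_cancel hx
  have hz₂ : z ∈ ⨆ (j) (_ : j ≠ d), D.eigenspace ((2 : k) ^ j) :=
    (iSup₂_mono fun j _ => hle j) hz
  have := (Submodule.disjoint_def.1 hind) z hz₁ hz₂
  rwa [this, add_zero]

variable {X : Type a}

theorem FreeLieAlgebra.mem_span_isMonomial
    (f : FreeLieAlgebra k X →ₗ⁅k⁆ FreeLieAlgebra k X)
    (hf : ∀ x, f (FreeLieAlgebra.of k x) = (2 : k) • FreeLieAlgebra.of k x) {d : ℕ}
    {l : FreeLieAlgebra k X} (hl : f l = (2 : k) ^ d • l) :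
    l ∈ Submodule.span k {l : FreeLieAlgebra k X | IsMonomial d l} := by
  refine mem_of_graded_eigenvector (f : FreeLieAlgebra k X →ₗ[k] FreeLieAlgebra k X) _
    IsMonomial.iSup_span_eq_top ?_ hl
  intro n x hx
  induction hx using Submodule.span_induction with
  | mem x h => exact h.map_eq f hf
  | zero => simp
  | add x y _ _ h₁ h₂ => rw [map_add, h₁, h₂, smul_add]
  | smul c x _ h => rw [map_smul, h, smul_comm]

end Homogeneous

/-! ### Free associative algebras on few generators. -/

section FreeAssoc

variable {k : Type u} [CommRing k]

theorem FreeAlgebra.exists_aeval {X : Type a} [Unique X] (r : FreeAlgebra k X) :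
    ∃ p : Polynomial k, r = Polynomial.aeval (FreeAlgebra.ι k default) p := by
  have h : r ∈ Algebra.adjoin k (Set.range (FreeAlgebra.ι k : X → FreeAlgebra k X)) := by
    rw [FreeAlgebra.adjoin_range_ι]
    trivial
  rw [Set.range_unique, Algebra.adjoin_singleton_eq_range_aeval] at h
  obtain ⟨p, hp⟩ := h
  exact ⟨p, hp.symm⟩

theorem FreeAlgebra.exists_algebraMap {X : Type a} [IsEmpty X] (r : FreeAlgebra k X) :
    ∃ c : k, r = algebraMap k _ c := by
  have h : r ∈ Algebra.adjoin k (Set.range (FreeAlgebra.ι k : X → FreeAlgebra k X)) := by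
    rw [FreeAlgebra.adjoin_range_ι]
    trivial
  rw [Set.range_eq_empty, Algebra.adjoin_empty] at h
  obtain ⟨c, hc⟩ := Algebra.mem_bot.1 h
  exact ⟨c, hc.symm⟩

theorem FreeAlgebra.ι_mul_ι_ne [Nontrivial k] {X : Type a} {x y : X} (h : x ≠ y) :
    FreeAlgebra.ι k x * FreeAlgebra.ι k y ≠ FreeAlgebra.ι k y * FreeAlgebra.ι k x := by
  classical
  intro he
  -- The matrix units `E₁₂` and `E₂₁` do not commute: their two products differ in the upper left
  -- entry.
  have := congrArg (FreeAlgebra.lift k fun z : X =>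
    if z = x then (!![0, 1; 0, 0] : Matrix (Fin 2) (Fin 2) k) else !![0, 0; 1, 0]) he
  simp only [map_mul, FreeAlgebra.lift_ι_apply, if_pos, if_neg h.symm] at this
  have := congrFun (congrFun this 0) 0
  simp at this

end FreeAssoc

/-! ### The universal property of `W(X, Y)`. -/

section Lift

attribute [local instance] LieRing.ofAssociativeRing LieAlgebra.ofAssociativeAlgebra

variable {k : Type u} [CommRing k]

theorem FreeActModule.lie_def {X : Type a} {Y : Type b} (l : FreeLieAlgebra k X)
    (x : FreeActModule k X Y) : ⁅l, x⁆ = freeLieToFreeAssoc k X l • x :=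
  rfl

variable {X₀ : Type a} {Y₀ : Type b} (W : FreeRep k X₀ Y₀)
  {L : Type v} {V : Type w} [LieRing L] [LieAlgebra k L] [AddCommGroup V] [Module k V]
  [LieRingModule L V] [LieModule k L V]

theorem FreeAlgebra.lift_toEnd_freeLieToFreeAssoc {X : Type a} (f : X → L)
    (l : FreeLieAlgebra k X) :
    FreeAlgebra.lift k (fun x => LieModule.toEnd k L V (f x)) (freeLieToFreeAssoc k X l) =
      LieModule.toEnd k L V (FreeLieAlgebra.lift k f l) := by
  refine FreeLieAlgebra.mem_of_forall_of_mem
    { LinearMap.eqLocus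
        ((FreeAlgebra.lift k fun x => LieModule.toEnd k L V (f x)).toLinearMap ∘ₗ
          freeLieToFreeAssoc k X)
        ((LieModule.toEnd k L V : L →ₗ[k] Module.End k V) ∘ₗ
          (FreeLieAlgebra.lift k f : FreeLieAlgebra k X →ₗ[k] L)) with
      lie_mem' := fun {l m} hl hm => ?_ } (fun x => ?_) l
  · change FreeAlgebra.lift k (fun x => LieModule.toEnd k L V (f x)) (freeLieToFreeAssoc k X l) =
      LieModule.toEnd k L V (FreeLieAlgebra.lift k f l) at hl
    change FreeAlgebra.lift k (fun x => LieModule.toEnd k L V (f x)) (freeLieToFreeAssoc k X m) =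
      LieModule.toEnd k L V (FreeLieAlgebra.lift k f m) at hm
    change FreeAlgebra.lift k (fun x => LieModule.toEnd k L V (f x))
      (freeLieToFreeAssoc k X ⁅l, m⁆) = LieModule.toEnd k L V (FreeLieAlgebra.lift k f ⁅l, m⁆)
    rw [freeLieToFreeAssoc_lie, map_sub, map_mul, map_mul, hl, hm, LieHom.map_lie, LieHom.map_lie,
      LieRing.of_associative_ring_bracket]
  · change FreeAlgebra.lift k (fun x => LieModule.toEnd k L V (f x))
      (freeLieToFreeAssoc k X (FreeLieAlgebra.of k x)) =
        LieModule.toEnd k L V (FreeLieAlgebra.lift k f (FreeLieAlgebra.of k x))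
    rw [freeLieToFreeAssoc_of, FreeAlgebra.lift_ι_apply, FreeLieAlgebra.lift_of_apply]

namespace FreeRep

/-- The generator `x` of the Lie algebra of `W`. -/
noncomputable def ofLie (x : W.X) : W.Lie :=
  FreeLieAlgebra.of k x

/-- The generator `y` of the module of `W`. -/
noncomputable def ofMod (y : W.Y) : W.Mod :=
  Finsupp.single y 1

/-- The homomorphism from a free representation with given values on the generators. -/
noncomputable def lift (f : W.X → L) (g : W.Y → V) : LieRepHom k W.Lie W.Mod L V where
  lie := FreeLieAlgebra.lift k f
  mod := Finsupp.lsum k fun y => LinearMap.applyₗ (g y) ∘ₗ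
    (FreeAlgebra.lift k fun x => LieModule.toEnd k L V (f x)).toLinearMap
  map_act l x := by
    induction x using Finsupp.induction_linear with
    | zero => simp
    | add x y hx hy => rw [map_add, lie_add, hx, hy, lie_add, map_add]
    | single y r =>
      rw [FreeActModule.lie_def, Finsupp.smul_single, smul_eq_mul, Finsupp.lsum_single,
        Finsupp.lsum_single, LinearMap.comp_apply, LinearMap.comp_apply, AlgHom.toLinearMap_apply,
        AlgHom.toLinearMap_apply, map_mul, FreeAlgebra.lift_toEnd_freeLieToFreeAssoc]
      rfl

@[simp]
theorem lift_ofLie (f : W.X → L) (g : W.Y → V) (x : W.X) : (W.lift f g).lie (W.ofLie x) = f x :=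
  FreeLieAlgebra.lift_of_apply (R := k) f x

@[simp]
theorem lift_ofMod (f : W.X → L) (g : W.Y → V) (y : W.Y) : (W.lift f g).mod (W.ofMod y) = g y := by
  simp [lift, ofMod]

variable {W}

/-- The module component of a homomorphism is automatically `A(X)`-linear, because `A(X)` is
generated by the letters, which act through the Lie algebra. Thus a homomorphism is determined by
its values on generators. -/
theorem map_single (F : LieRepHom k W.Lie W.Mod L V) (y : W.Y)
    (r : FreeAlgebra k W.X) : F.mod (Finsupp.single y r) =
      FreeAlgebra.lift k (fun x => LieModule.toEnd k L V (F.lie (W.ofLie x))) r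
        (F.mod (W.ofMod y)) := by
  have key : ∀ (r : FreeAlgebra k W.X) (x : W.Mod), F.mod (r • x) =
      FreeAlgebra.lift k (fun x => LieModule.toEnd k L V (F.lie (W.ofLie x))) r (F.mod x) := by
    intro r
    induction r using FreeAlgebra.induction with
    | grade0 c => simp
    | grade1 x =>
      intro v
      rw [FreeAlgebra.lift_ι_apply, LieModule.toEnd_apply_apply, F.map_act, FreeActModule.lie_def,
        ofLie, freeLieToFreeAssoc_of]
    | mul r s hr hs =>
      intro v
      rw [mul_smul, hr, hs, map_mul, Module.End.mul_apply]
    | add r s hr hs =>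
      intro v
      rw [add_smul, map_add, hr, hs, map_add, LinearMap.add_apply]
  rw [← key, ofMod, Finsupp.smul_single, smul_eq_mul, mul_one]

theorem hom_ext {F G : LieRepHom k W.Lie W.Mod L V}
    (hl : ∀ x, F.lie (W.ofLie x) = G.lie (W.ofLie x))
    (hm : ∀ y, F.mod (W.ofMod y) = G.mod (W.ofMod y)) : F = G := by
  ext1
  · exact FreeLieAlgebra.hom_ext hl
  · refine Finsupp.lhom_ext fun y r => ?_
    simp only [map_single, hl, hm]

end FreeRep

end Lift

/-! ### Categorical recognition of the one-generator objects. -/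

namespace FreeRep

section Generators

variable {k : Type u} [Field k] {X₀ : Type a} {Y₀ : Type b}

@[simp]
theorem comp_lie {U V W : FreeRep k X₀ Y₀} (f : U ⟶ V) (g : V ⟶ W) (l : U.Lie) :
    LieRepHom.lie (f ≫ g) l = g.lie (f.lie l) :=
  rfl

@[simp]
theorem comp_mod {U V W : FreeRep k X₀ Y₀} (f : U ⟶ V) (g : V ⟶ W) (x : U.Mod) :
    LieRepHom.mod (f ≫ g) x = g.mod (f.mod x) :=
  rfl

@[simp]
theorem id_lie (U : FreeRep k X₀ Y₀) (l : U.Lie) : LieRepHom.lie (𝟙 U) l = l :=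
  rfl

@[simp]
theorem id_mod (U : FreeRep k X₀ Y₀) (x : U.Mod) : LieRepHom.mod (𝟙 U) x = x :=
  rfl

/-- The zero morphism. -/
noncomputable def zeroHom (U V : FreeRep k X₀ Y₀) : U ⟶ V where
  lie := 0
  mod := 0
  map_act l x := by simp

@[simp]
theorem zeroHom_lie (U V : FreeRep k X₀ Y₀) (l : U.Lie) : (zeroHom U V).lie l = 0 :=
  rfl

@[simp]
theorem zeroHom_mod (U V : FreeRep k X₀ Y₀) (x : U.Mod) : (zeroHom U V).mod x = 0 :=
  rfl

theorem ofLie_ne_zero {U : FreeRep k X₀ Y₀} (x : U.X) : U.ofLie x ≠ 0 :=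
  FreeLieAlgebra.of_ne_zero x

theorem ofMod_ne_zero {U : FreeRep k X₀ Y₀} (y : U.Y) : U.ofMod y ≠ 0 :=
  Finsupp.single_ne_zero.2 one_ne_zero

/-- `P` is the free representation on the single element `p` of its Lie algebra. -/
structure IsLieGen (P : FreeRep k X₀ Y₀) (p : P.Lie) : Prop where
  ne_zero : p ≠ 0
  lie_eq : ∀ l : P.Lie, ∃ c : k, l = c • p
  mod_eq : ∀ x : P.Mod, x = 0
  exists_hom : ∀ (U : FreeRep k X₀ Y₀) (l : U.Lie), ∃ f : P ⟶ U, f.lie p = l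

/-- `P` is the free representation on the single element `p` of its module. -/
structure IsModGen (P : FreeRep k X₀ Y₀) (p : P.Mod) : Prop where
  ne_zero : p ≠ 0
  mod_eq : ∀ x : P.Mod, ∃ c : k, x = c • p
  lie_eq : ∀ l : P.Lie, l = 0
  exists_hom : ∀ (U : FreeRep k X₀ Y₀) (x : U.Mod), ∃ f : P ⟶ U, f.mod p = x

theorem IsLieGen.hom_ext {P U : FreeRep k X₀ Y₀} {p : P.Lie} (h : IsLieGen P p) {f g : P ⟶ U}
    (hfg : f.lie p = g.lie p) : f = g := by
  apply LieRepHom.ext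
  · refine LieHom.ext fun l => ?_
    obtain ⟨c, rfl⟩ := h.lie_eq l
    rw [map_smul, map_smul, hfg]
  · refine LinearMap.ext fun x => ?_
    rw [h.mod_eq x, map_zero, map_zero]

theorem IsModGen.hom_ext {P U : FreeRep k X₀ Y₀} {p : P.Mod} (h : IsModGen P p) {f g : P ⟶ U}
    (hfg : f.mod p = g.mod p) : f = g := by
  apply LieRepHom.ext
  · refine LieHom.ext fun l => ?_
    rw [h.lie_eq l, map_zero, map_zero]
  · refine LinearMap.ext fun x => ?_
    obtain ⟨c, rfl⟩ := h.mod_eq x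
    rw [map_smul, map_smul, hfg]

theorem isLieGen_singleton (x : X₀) :
    IsLieGen (⟨{x}, ∅⟩ : FreeRep k X₀ Y₀) (ofLie _ ⟨x, Finset.mem_singleton_self x⟩) where
  ne_zero := ofLie_ne_zero _
  lie_eq l := by
    let : Unique (({x} : Finset X₀) : Type a) :=
      ⟨⟨⟨x, Finset.mem_singleton_self x⟩⟩, fun z => Subtype.ext (Finset.mem_singleton.1 z.2)⟩
    exact FreeLieAlgebra.exists_smul_of l
  mod_eq v := Finsupp.ext fun y => absurd y.2 (Finset.notMem_empty _)
  exists_hom U l := ⟨lift _ (fun _ => l) 0, lift_ofLie _ _ _ _⟩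

theorem isModGen_singleton (y : Y₀) :
    IsModGen (⟨∅, {y}⟩ : FreeRep k X₀ Y₀) (ofMod _ ⟨y, Finset.mem_singleton_self y⟩) where
  ne_zero := ofMod_ne_zero _
  mod_eq v := by
    have : IsEmpty ((∅ : Finset X₀) : Type a) := ⟨fun z => absurd z.2 (Finset.notMem_empty _)⟩
    obtain ⟨c, hc⟩ := FreeAlgebra.exists_algebraMap (v ⟨y, Finset.mem_singleton_self y⟩)
    refine ⟨c, Finsupp.ext fun z => ?_⟩
    obtain rfl : z = ⟨y, Finset.mem_singleton_self y⟩ := Subtype.ext (Finset.mem_singleton.1 z.2)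
    rw [hc, ofMod, Finsupp.smul_single, Finsupp.single_eq_same, Algebra.algebraMap_eq_smul_one]
  lie_eq l := by
    have : IsEmpty ((∅ : Finset X₀) : Type a) := ⟨fun z => absurd z.2 (Finset.notMem_empty _)⟩
    exact FreeLieAlgebra.eq_zero_of_isEmpty l
  exists_hom U v := ⟨lift _ 0 (fun _ => v), lift_ofMod _ _ _ _⟩

/-- The endomorphism monoid of `P` has exactly two idempotents. -/
def HasTwoIdempotents (P : FreeRep k X₀ Y₀) : Prop :=
  ∃ e : P ⟶ P, e ≠ 𝟙 P ∧ e ≫ e = e ∧ ∀ e' : P ⟶ P, e' ≫ e' = e' → e' = 𝟙 P ∨ e' = e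

theorem eq_zero_or_one_of_smul_smul {M : Type v} [AddCommGroup M] [Module k M] {p : M}
    (hp : p ≠ 0) {c : k} (h : c • c • p = c • p) : c = 0 ∨ c = 1 := by
  rw [smul_smul] at h
  have h' : c * c = c := smul_left_injective k hp h
  rcases eq_or_ne c 0 with hc | hc
  · exact Or.inl hc
  · exact Or.inr (mul_left_cancel₀ hc (h'.trans (mul_one c).symm))

theorem IsLieGen.hasTwoIdempotents {P : FreeRep k X₀ Y₀} {p : P.Lie} (h : IsLieGen P p) :
    HasTwoIdempotents P := by
  refine ⟨zeroHom P P, fun he => h.ne_zero ?_, rfl, fun e he => ?_⟩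
  · have := congrArg (fun f : P ⟶ P => f.lie p) he
    simpa using this.symm
  · obtain ⟨c, hc⟩ := h.lie_eq (e.lie p)
    have h₂ := congrArg (fun f : P ⟶ P => f.lie p) he
    simp only [comp_lie, hc, map_smul] at h₂
    rcases eq_zero_or_one_of_smul_smul h.ne_zero h₂ with rfl | rfl
    · exact Or.inr (h.hom_ext (by simp [hc]))
    · exact Or.inl (h.hom_ext (by simp [hc]))

theorem IsModGen.hasTwoIdempotents {P : FreeRep k X₀ Y₀} {p : P.Mod} (h : IsModGen P p) :
    HasTwoIdempotents P := by
  refine ⟨zeroHom P P, fun he => h.ne_zero ?_, rfl, fun e he => ?_⟩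
  · have := congrArg (fun f : P ⟶ P => f.mod p) he
    simpa using this.symm
  · obtain ⟨c, hc⟩ := h.mod_eq (e.mod p)
    have h₂ := congrArg (fun f : P ⟶ P => f.mod p) he
    simp only [comp_mod, hc, map_smul] at h₂
    rcases eq_zero_or_one_of_smul_smul (k := k) (M := P.Mod) h.ne_zero h₂ with rfl | rfl
    · exact Or.inr (h.hom_ext (by simp [hc]))
    · exact Or.inl (h.hom_ext (by simp [hc]))

theorem HasTwoIdempotents.eq_id_or_eq_zero {P : FreeRep k X₀ Y₀} (h : HasTwoIdempotents P)
    {e : P ⟶ P} (he : e ≫ e = e) : e = 𝟙 P ∨ e = zeroHom P P := by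
  obtain ⟨e₀, hne, hid, hall⟩ := h
  rcases hall (zeroHom P P) rfl with h₀ | h₀
  · refine absurd ?_ hne
    calc e₀ = e₀ ≫ zeroHom P P := by rw [h₀, Category.comp_id]
      _ = zeroHom P P := rfl
      _ = 𝟙 P := h₀
  · rw [h₀]
    exact hall e he

/-- Keeping one generator and killing all the others is a non-zero idempotent, hence the identity,
so there are no other generators. -/
theorem HasTwoIdempotents.isLieGen_or_isModGen {P : FreeRep k X₀ Y₀} (h : HasTwoIdempotents P) :
    (∃ p, IsLieGen P p) ∨ ∃ p, IsModGen P p := by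
  classical
  obtain ⟨X, Y⟩ := P
  rcases X.eq_empty_or_nonempty with rfl | ⟨x, hx⟩
  · rcases Y.eq_empty_or_nonempty with rfl | ⟨y, hy⟩
    · obtain ⟨e, hne, -, -⟩ := h
      refine absurd (hom_ext (fun z => ?_) fun z => ?_) hne <;>
        exact absurd z.2 (Finset.notMem_empty _)
    · obtain rfl : Y = {y} := by
        refine Finset.eq_singleton_iff_unique_mem.2 ⟨hy, fun y' hy' => ?_⟩
        by_contra hyy
        let P : FreeRep k X₀ Y₀ := ⟨∅, Y⟩
        let e : P ⟶ P := lift P 0 fun z => if z.1 = y then P.ofMod z else 0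
        have hey : e.mod (P.ofMod ⟨y, hy⟩) = P.ofMod ⟨y, hy⟩ := by simp [e]
        have hey' : e.mod (P.ofMod ⟨y', hy'⟩) = 0 := by simp [e, hyy]
        have he : e ≫ e = e := by
          refine hom_ext (fun z => absurd z.2 (Finset.notMem_empty _)) fun z => ?_
          by_cases hz : z.1 = y <;> simp [e, hz]
        rcases h.eq_id_or_eq_zero he with h' | h'
        · rw [h'] at hey'
          exact ofMod_ne_zero _ hey'
        · rw [h'] at hey
          exact ofMod_ne_zero _ hey.symm
      exact Or.inr ⟨_, isModGen_singleton y⟩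
  · let P : FreeRep k X₀ Y₀ := ⟨X, Y⟩
    let e : P ⟶ P := lift P (fun z => if z.1 = x then P.ofLie z else 0) 0
    have hex : e.lie (P.ofLie ⟨x, hx⟩) = P.ofLie ⟨x, hx⟩ := by simp [e]
    have he : e ≫ e = e := by
      refine hom_ext (fun z => ?_) fun z => ?_
      · by_cases hz : z.1 = x <;> simp [e, hz]
      · simp [e]
    have h' : e = 𝟙 P := by
      refine (h.eq_id_or_eq_zero he).resolve_right fun h' => ?_
      rw [h'] at hex
      exact ofLie_ne_zero _ hex.symm
    obtain rfl : X = {x} := by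
      refine Finset.eq_singleton_iff_unique_mem.2 ⟨hx, fun x' hx' => ?_⟩
      by_contra hxx
      have hex' : e.lie (P.ofLie ⟨x', hx'⟩) = 0 := by simp [e, hxx]
      rw [h'] at hex'
      exact ofLie_ne_zero _ hex'
    obtain rfl : Y = ∅ := by
      refine Finset.eq_empty_iff_forall_notMem.2 fun y hy => ?_
      have hey : e.mod (P.ofMod ⟨y, hy⟩) = 0 := by simp [e]
      rw [h'] at hey
      exact ofMod_ne_zero _ hey
    exact Or.inl ⟨_, isLieGen_singleton x⟩

variable (Φ : FreeRep k X₀ Y₀ ⥤ FreeRep k X₀ Y₀) [Φ.Full]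

theorem HasTwoIdempotents.map [Φ.Faithful] {P : FreeRep k X₀ Y₀} (h : HasTwoIdempotents P) :
    HasTwoIdempotents (Φ.obj P) := by
  obtain ⟨e, hne, hid, hall⟩ := h
  refine ⟨Φ.map e, fun h => hne (Φ.map_injective (h.trans (Φ.map_id P).symm)), ?_, fun e' he' => ?_⟩
  · rw [← Φ.map_comp, hid]
  · obtain ⟨f, rfl⟩ := Φ.map_surjective e'
    rcases hall f (Φ.map_injective (by rw [Φ.map_comp, he'])) with rfl | rfl
    · exact Or.inl (Φ.map_id P)
    · exact Or.inr rfl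

variable [Φ.EssSurj]

/-- If the kinds were exchanged, `Φ.obj W`, for `W` on one `x` and one `y`, would have a free module
element coming from `x` and a free Lie element coming from `y`. The Lie algebra of `W` is the line
through `x`, so Lie element acting on module element would be a multiple of that module element,
which is false for free generators. -/
theorem not_isModGen_and_isLieGen_map [Nonempty X₀] [Nonempty Y₀] {A B : FreeRep k X₀ Y₀}
    {p : A.Lie} {q : B.Mod} (hp : IsLieGen A p) (hq : IsModGen B q) {q' : (Φ.obj A).Mod}
    {p' : (Φ.obj B).Lie} (hq' : IsModGen (Φ.obj A) q') (hp' : IsLieGen (Φ.obj B) p') : False := by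
  obtain ⟨x₀⟩ := ‹Nonempty X₀›
  obtain ⟨y₀⟩ := ‹Nonempty Y₀›
  let W : FreeRep k X₀ Y₀ := ⟨{x₀}, {y₀}⟩
  let x : W.X := ⟨x₀, Finset.mem_singleton_self x₀⟩
  let y : W.Y := ⟨y₀, Finset.mem_singleton_self y₀⟩
  have hx : ∀ z : W.X, z = x := fun z => Subtype.ext (Finset.mem_singleton.1 z.2)
  obtain ⟨i, hi⟩ := hp.exists_hom W (W.ofLie x)
  obtain ⟨j, hj⟩ := hq.exists_hom W (W.ofMod y)
  obtain ⟨g, hg⟩ := hq'.exists_hom (Φ.obj W) ⁅(Φ.map j).lie p', (Φ.map i).mod q'⁆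
  obtain ⟨f, rfl⟩ := Φ.map_surjective g
  -- Every element of the Lie algebra of `W` is a multiple of `x`, so every morphism `A ⟶ W` factors
  -- through `i`.
  have hfac : ∃ t : A ⟶ A, f = t ≫ i := by
    obtain ⟨c, hc⟩ : ∃ c : k, f.lie p = c • W.ofLie x := by
      let : Unique W.X := ⟨⟨x⟩, hx⟩
      exact FreeLieAlgebra.exists_smul_of (f.lie p)
    obtain ⟨t, ht⟩ := hp.exists_hom A (c • p)
    exact ⟨t, hp.hom_ext (by rw [comp_lie, ht, map_smul, hi, hc])⟩
  obtain ⟨t, rfl⟩ := hfac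
  obtain ⟨d, hd⟩ := hq'.mod_eq ((Φ.map t).mod q')
  rw [Φ.map_comp, comp_mod, hd, map_smul] at hg
  obtain ⟨W', ⟨e⟩⟩ : ∃ W', Nonempty (Φ.obj W' ≅ W) := ⟨_, ⟨Φ.objObjPreimageIso W⟩⟩
  obtain ⟨f₁, hf₁⟩ := hq'.exists_hom W (W.ofMod y)
  obtain ⟨f₂, hf₂⟩ := hp'.exists_hom W (W.ofLie x)
  obtain ⟨a, ha⟩ := Φ.map_surjective (f₁ ≫ e.inv)
  obtain ⟨b, hb⟩ := Φ.map_surjective (f₂ ≫ e.inv)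
  -- Composed with `e.hom`, the image of `h₀` sends the two elements of `Φ.obj W` to the genuine
  -- generators, turning `hg` into `x • y = d • y`.
  let h₀ : W ⟶ W' := lift W (fun _ => a.lie p) fun _ => b.mod q
  have hia : i ≫ h₀ = a := hp.hom_ext (by simp [hi, h₀])
  have hjb : j ≫ h₀ = b := hq.hom_ext (by simp [hj, h₀])
  have hv : (Φ.map h₀ ≫ e.hom).mod ((Φ.map i).mod q') = W.ofMod y := by
    have : Φ.map i ≫ Φ.map h₀ ≫ e.hom = f₁ := by
      rw [← Category.assoc, ← Φ.map_comp, hia, ha, Category.assoc, e.inv_hom_id, Category.comp_id]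
    rw [← hf₁, ← this]
    rfl
  have hl : (Φ.map h₀ ≫ e.hom).lie ((Φ.map j).lie p') = W.ofLie x := by
    have : Φ.map j ≫ Φ.map h₀ ≫ e.hom = f₂ := by
      rw [← Category.assoc, ← Φ.map_comp, hjb, hb, Category.assoc, e.inv_hom_id, Category.comp_id]
    rw [← hf₂, ← this]
    rfl
  have key := congrArg (LieRepHom.mod (Φ.map h₀ ≫ e.hom)) hg
  rw [map_smul, hv, ← LieRepHom.map_act, hl, hv, FreeActModule.lie_def, ofLie,
    freeLieToFreeAssoc_of, ofMod, Finsupp.smul_single, Finsupp.smul_single] at key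
  have key' := Finsupp.single_injective _ key
  rw [smul_eq_mul, mul_one, ← Algebra.algebraMap_eq_smul_one] at key'
  exact FreeAlgebra.ι_ne_algebraMap _ _ key'.symm

theorem exists_isLieGen_and_isModGen_map [Φ.Faithful] [Nonempty X₀] [Nonempty Y₀]
    {A B : FreeRep k X₀ Y₀} {p : A.Lie} {q : B.Mod} (hp : IsLieGen A p) (hq : IsModGen B q) :
    (∃ p', IsLieGen (Φ.obj A) p') ∧ ∃ q', IsModGen (Φ.obj B) q' := by
  -- There is only the zero morphism `A ⟶ B`; this excludes that both images are of the same kind.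
  have hAB : ∀ f g : Φ.obj A ⟶ Φ.obj B, f = g := by
    intro f g
    obtain ⟨f, rfl⟩ := Φ.map_surjective f
    obtain ⟨g, rfl⟩ := Φ.map_surjective g
    rw [hp.hom_ext ((hq.lie_eq (f.lie p)).trans (hq.lie_eq (g.lie p)).symm)]
  rcases (hp.hasTwoIdempotents.map Φ).isLieGen_or_isModGen with ⟨p', hp'⟩ | ⟨p', hp'⟩ <;>
    rcases (hq.hasTwoIdempotents.map Φ).isLieGen_or_isModGen with ⟨q', hq'⟩ | ⟨q', hq'⟩
  · obtain ⟨f, hf⟩ := hp'.exists_hom (Φ.obj B) q'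
    rw [hAB f (zeroHom _ _)] at hf
    exact absurd hf.symm hq'.ne_zero
  · exact ⟨⟨p', hp'⟩, q', hq'⟩
  · exact (not_isModGen_and_isLieGen_map Φ hp hq hp' hq').elim
  · obtain ⟨f, hf⟩ := hp'.exists_hom (Φ.obj B) q'
    rw [hAB f (zeroHom _ _)] at hf
    exact absurd hf.symm hq'.ne_zero

end Generators

end FreeRep

/-! ### Natural operations on free representations. -/

namespace FreeRep

section NaturalOperations

variable {k : Type u} [Field k] {X₀ : Type a} {Y₀ : Type b}

/-- The endomorphism of `L(X)` that doubles the generators, extended to a free representation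
by the identity on the generators of the module. -/
noncomputable def double (W : FreeRep k X₀ Y₀) : W ⟶ W :=
  lift W (fun x => (2 : k) • W.ofLie x) W.ofMod

theorem exists_morphism_of_ne [DecidableEq X₀] {x₁ x₂ : X₀} (hx : x₁ ≠ x₂) (W : FreeRep k X₀ Y₀)
    (l m : W.Lie) :
    ∃ f : (⟨{x₁, x₂}, ∅⟩ : FreeRep k X₀ Y₀) ⟶ W,
      f.lie (ofLie _ ⟨x₁, by simp⟩) = l ∧ f.lie (ofLie _ ⟨x₂, by simp⟩) = m :=
  ⟨lift _ (fun z => if z.1 = x₁ then l else m) 0, by simp, by simp [hx.symm]⟩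

/-- Naturality reduces everything to the value on two free generators. By `hdeg` that value is an
eigenvector of the doubling endomorphism for the eigenvalue `2`, hence homogeneous of degree one. -/
theorem natural_lie_op_degree_one [CharZero k] [Nontrivial X₀]
    (op : ∀ W : FreeRep k X₀ Y₀, W.Lie → W.Lie → W.Lie)
    (hnat : ∀ (W U : FreeRep k X₀ Y₀) (f : W ⟶ U) (l m : W.Lie),
      f.lie (op W l m) = op U (f.lie l) (f.lie m))
    (hdeg : ∀ (W : FreeRep k X₀ Y₀) (l m : W.Lie),
      op W ((2 : k) • l) ((2 : k) • m) = (2 : k) • op W l m) :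
    ∃ c d : k, ∀ (W : FreeRep k X₀ Y₀) (l m : W.Lie), op W l m = c • l + d • m := by
  classical
  obtain ⟨x₁, x₂, hx⟩ := exists_pair_ne X₀
  let P : FreeRep k X₀ Y₀ := ⟨{x₁, x₂}, ∅⟩
  let u₁ : P.Lie := ofLie P ⟨x₁, by simp [P]⟩
  let u₂ : P.Lie := ofLie P ⟨x₂, by simp [P]⟩
  have hu : op P u₁ u₂ ∈ Submodule.span k {l : P.Lie | FreeLieAlgebra.IsMonomial 1 l} := by
    refine FreeLieAlgebra.mem_span_isMonomial P.double.lie (lift_ofLie _ _ _) ?_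
    rw [hnat, pow_one, ← hdeg]
    congr 1 <;> exact lift_ofLie _ _ _ _
  have hu' : op P u₁ u₂ ∈ Submodule.span k {u₁, u₂} := by
    refine Submodule.span_mono ?_ hu
    intro l hl
    obtain ⟨⟨x, hx'⟩, rfl⟩ := FreeLieAlgebra.IsMonomial.eq_of hl
    have : x = x₁ ∨ x = x₂ := by simpa [P] using hx'
    rcases this with rfl | rfl
    · exact Or.inl rfl
    · exact Or.inr rfl
  obtain ⟨c, d, hcd⟩ := Submodule.mem_span_pair.1 hu'
  refine ⟨c, d, fun W l m => ?_⟩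
  obtain ⟨f, rfl, rfl⟩ := exists_morphism_of_ne hx W l m
  rw [← hnat]
  change f.lie (op P u₁ u₂) = _
  rw [← hcd, map_add, map_smul, map_smul]

theorem natural_lie_op_degree_two [CharZero k] [Nontrivial X₀]
    (op : ∀ W : FreeRep k X₀ Y₀, W.Lie → W.Lie → W.Lie)
    (hnat : ∀ (W U : FreeRep k X₀ Y₀) (f : W ⟶ U) (l m : W.Lie),
      f.lie (op W l m) = op U (f.lie l) (f.lie m))
    (hdeg : ∀ (W : FreeRep k X₀ Y₀) (l m : W.Lie),
      op W ((2 : k) • l) ((2 : k) • m) = (2 : k) ^ 2 • op W l m) :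
    ∃ c : k, ∀ (W : FreeRep k X₀ Y₀) (l m : W.Lie), op W l m = c • ⁅l, m⁆ := by
  classical
  obtain ⟨x₁, x₂, hx⟩ := exists_pair_ne X₀
  let P : FreeRep k X₀ Y₀ := ⟨{x₁, x₂}, ∅⟩
  let u₁ : P.Lie := ofLie P ⟨x₁, by simp [P]⟩
  let u₂ : P.Lie := ofLie P ⟨x₂, by simp [P]⟩
  have hu : op P u₁ u₂ ∈ Submodule.span k {l : P.Lie | FreeLieAlgebra.IsMonomial 2 l} := by
    refine FreeLieAlgebra.mem_span_isMonomial P.double.lie (lift_ofLie _ _ _) ?_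
    rw [hnat, ← hdeg]
    congr 1 <;> exact lift_ofLie _ _ _ _
  have hu' : op P u₁ u₂ ∈ Submodule.span k {⁅u₁, u₂⁆} := by
    refine Submodule.span_le.2 ?_ hu
    intro l hl
    obtain ⟨⟨x, hx'⟩, ⟨y, hy'⟩, rfl⟩ := FreeLieAlgebra.IsMonomial.eq_lie_of hl
    have h₁ : x = x₁ ∨ x = x₂ := by simpa [P] using hx'
    have h₂ : y = x₁ ∨ y = x₂ := by simpa [P] using hy'
    -- In two letters, antisymmetry leaves a single bracket of degree two up to scalars.
    rw [SetLike.mem_coe, Submodule.mem_span_singleton]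
    rcases h₁ with rfl | rfl <;> rcases h₂ with rfl | rfl
    · exact ⟨0, by rw [lie_self, zero_smul]⟩
    · exact ⟨1, one_smul _ _⟩
    · exact ⟨-1, by rw [neg_smul, one_smul, lie_skew]; rfl⟩
    · exact ⟨0, by rw [lie_self, zero_smul]⟩
  obtain ⟨c, hc⟩ := Submodule.mem_span_singleton.1 hu'
  refine ⟨c, fun W l m => ?_⟩
  obtain ⟨f, rfl, rfl⟩ := exists_morphism_of_ne hx W l m
  rw [← hnat]
  change f.lie (op P u₁ u₂) = _
  rw [← hc, map_smul, LieHom.map_lie]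

theorem natural_act_op_degree_one [CharZero k] [Nonempty X₀] [Nonempty Y₀]
    (op : ∀ W : FreeRep k X₀ Y₀, W.Lie → W.Mod → W.Mod)
    (hnat : ∀ (W U : FreeRep k X₀ Y₀) (f : W ⟶ U) (l : W.Lie) (v : W.Mod),
      f.mod (op W l v) = op U (f.lie l) (f.mod v))
    (hdeg : ∀ (W : FreeRep k X₀ Y₀) (l : W.Lie) (v : W.Mod),
      op W ((2 : k) • l) v = (2 : k) • op W l v) :
    ∃ c : k, ∀ (W : FreeRep k X₀ Y₀) (l : W.Lie) (v : W.Mod), op W l v = c • ⁅l, v⁆ := by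
  obtain ⟨x₀⟩ := ‹Nonempty X₀›
  obtain ⟨y₀⟩ := ‹Nonempty Y₀›
  let P : FreeRep k X₀ Y₀ := ⟨{x₀}, {y₀}⟩
  let x : P.X := ⟨x₀, Finset.mem_singleton_self x₀⟩
  let y : P.Y := ⟨y₀, Finset.mem_singleton_self y₀⟩
  -- The elements `xⁿ y` span the module and grade it: doubling `x` while fixing `y` multiplies the
  -- `n`-th by `2 ^ n`.
  let mon : ℕ → P.Mod := fun n => Finsupp.single y (FreeAlgebra.ι k x ^ n)
  have hmon_zero : mon 0 = P.ofMod y := by simp [mon, ofMod]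
  have hmon_succ : ∀ n, mon (n + 1) = ⁅P.ofLie x, mon n⁆ := fun n => by
    rw [FreeActModule.lie_def, ofLie, freeLieToFreeAssoc_of, Finsupp.smul_single, smul_eq_mul,
      ← pow_succ']
  have hD : ∀ n, P.double.mod (mon n) = (2 : k) ^ n • mon n := by
    intro n
    induction n with
    | zero => rw [hmon_zero, pow_zero, one_smul]; exact lift_ofMod _ _ _ _
    | succ n ih =>
      have : P.double.lie (P.ofLie x) = (2 : k) • P.ofLie x := lift_ofLie _ _ _ _
      rw [hmon_succ, ← LieRepHom.map_act, ih, this, smul_lie,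
        lie_smul ((2 : k) ^ n) (P.ofLie x) (mon n), smul_smul, pow_succ']
  have htop : ⨆ n, Submodule.span k {mon n} = ⊤ := by
    rw [eq_top_iff]
    intro v _
    let _ : Unique P.X := ⟨⟨x⟩, fun z => Subtype.ext (Finset.mem_singleton.1 z.2)⟩
    obtain ⟨p, hp⟩ := FreeAlgebra.exists_aeval (v y)
    have hv : v = ∑ i ∈ Finset.range (p.natDegree + 1), p.coeff i • mon i := by
      have h₁ : v = Finsupp.single y (v y) := by
        refine Finsupp.ext fun z => ?_
        obtain rfl : z = y := Subtype.ext (Finset.mem_singleton.1 z.2)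
        rw [Finsupp.single_eq_same]
      rw [h₁, hp, Polynomial.aeval_eq_sum_range, Finsupp.single_finsetSum]
      exact Finset.sum_congr rfl fun i _ => (Finsupp.smul_single _ _ _).symm
    rw [hv]
    exact Submodule.sum_mem _ fun i _ => Submodule.smul_mem _ _
      (Submodule.mem_iSup_of_mem i (Submodule.mem_span_singleton_self _))
  have hu : op P (P.ofLie x) (P.ofMod y) ∈ Submodule.span k {mon 1} := by
    refine mem_of_graded_eigenvector P.double.mod (fun n => Submodule.span k {mon n}) htop ?_ ?_
    · intro n v hv
      obtain ⟨c, rfl⟩ := Submodule.mem_span_singleton.1 hv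
      rw [map_smul, hD, smul_comm]
    · rw [hnat, pow_one, ← hdeg]
      congr 1
      · exact lift_ofLie _ _ _ _
      · exact lift_ofMod _ _ _ _
  obtain ⟨c, hc⟩ := Submodule.mem_span_singleton.1 hu
  refine ⟨c, fun W l v => ?_⟩
  let f : P ⟶ W := lift P (fun _ => l) fun _ => v
  have hl : f.lie (P.ofLie x) = l := lift_ofLie _ _ _ _
  have hv : f.mod (P.ofMod y) = v := lift_ofMod _ _ _ _
  have h := hnat _ _ f (P.ofLie x) (P.ofMod y)
  rw [hl, hv] at h
  rw [← h, ← hc, hmon_succ, hmon_zero, map_smul, ← LieRepHom.map_act, hl, hv]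

/-- No homogeneity is needed here: the universal pair lives over the empty set of letters, where
`A(∅) = k`, so only linear combinations exist. -/
theorem natural_mod_op [Nontrivial Y₀] (op : ∀ W : FreeRep k X₀ Y₀, W.Mod → W.Mod → W.Mod)
    (hnat : ∀ (W U : FreeRep k X₀ Y₀) (f : W ⟶ U) (v w : W.Mod),
      f.mod (op W v w) = op U (f.mod v) (f.mod w)) :
    ∃ c d : k, ∀ (W : FreeRep k X₀ Y₀) (v w : W.Mod), op W v w = c • v + d • w := by
  classical
  obtain ⟨y₁, y₂, hy⟩ := exists_pair_ne Y₀
  let P : FreeRep k X₀ Y₀ := ⟨∅, {y₁, y₂}⟩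
  let z₁ : P.Y := ⟨y₁, by simp [P]⟩
  let z₂ : P.Y := ⟨y₂, by simp [P]⟩
  have : IsEmpty P.X := ⟨fun z => absurd z.2 (Finset.notMem_empty _)⟩
  obtain ⟨c, hc⟩ := FreeAlgebra.exists_algebraMap (op P (P.ofMod z₁) (P.ofMod z₂) z₁)
  obtain ⟨d, hd⟩ := FreeAlgebra.exists_algebraMap (op P (P.ofMod z₁) (P.ofMod z₂) z₂)
  have hz : z₁ ≠ z₂ := fun h => hy (congrArg Subtype.val h)
  have hu : op P (P.ofMod z₁) (P.ofMod z₂) = c • P.ofMod z₁ + d • P.ofMod z₂ := by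
    ext ⟨z, hz'⟩
    have h : z = y₁ ∨ z = y₂ := by simpa [P] using hz'
    rcases h with rfl | rfl
    · refine hc.trans ?_
      change _ = (c • Finsupp.single z₁ 1 + d • Finsupp.single z₂ 1 : P.Mod) z₁
      simp [hz, Algebra.algebraMap_eq_smul_one]
    · refine hd.trans ?_
      change _ = (c • Finsupp.single z₁ 1 + d • Finsupp.single z₂ 1 : P.Mod) z₂
      simp [hz.symm, Algebra.algebraMap_eq_smul_one]
  refine ⟨c, d, fun W v w => ?_⟩
  let f : P ⟶ W := lift P 0 fun z => if z = z₁ then v else w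
  have hv : f.mod (P.ofMod z₁) = v := by simp [f]
  have hw : f.mod (P.ofMod z₂) = w := by simp [f, hz.symm]
  have h := hnat _ _ f (P.ofMod z₁) (P.ofMod z₂)
  rw [hv, hw] at h
  rw [← h, hu, map_add, map_smul, map_smul, hv, hw]

end NaturalOperations

end FreeRep

/-! ### The action of an automorphism on elements. -/

namespace FreeRep

/-- A bijection of lines transports the scalar multiplication to a bijection of the scalars. -/
theorem exists_bijective_scalar {k : Type u} [Field k] {M : Type v} {M' : Type w} [AddCommGroup M]
    [Module k M] [AddCommGroup M'] [Module k M'] {p : M} {p' : M'} (hp : p ≠ 0) (hp' : p' ≠ 0)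
    (hM : ∀ x : M, ∃ c : k, x = c • p) (hM' : ∀ x : M', ∃ c : k, x = c • p') (s : M → M')
    (hs : Function.Bijective s) :
    ∃ φ : k → k, Function.Bijective φ ∧ ∀ c, c • p' = s (φ c • p) := by
  have h : ∀ c : k, ∃ d : k, c • p' = s (d • p) := by
    intro c
    obtain ⟨x, hx⟩ := hs.2 (c • p')
    obtain ⟨d, rfl⟩ := hM x
    exact ⟨d, hx.symm⟩
  choose φ hφ using h
  refine ⟨φ, ⟨fun c d hcd => smul_left_injective k hp' ?_, fun d => ?_⟩, hφ⟩
  · change c • p' = d • p'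
    rw [hφ, hφ, hcd]
  · obtain ⟨c, hc⟩ := hM' (s (d • p))
    exact ⟨c, smul_left_injective k hp (hs.1 ((hφ c).symm.trans hc.symm))⟩

theorem eq_id_of_forall_ringEquiv {k : Type u} [Field k]
    (hAut : ∀ σ : k ≃+* k, σ = RingEquiv.refl k)
    {φ : k → k} (hφ : Function.Bijective φ) (hmul : ∀ c d, φ (c * d) = φ c * φ d)
    (hadd : ∀ c d, φ (c + d) = φ c + φ d) (c : k) : φ c = c :=
  congrArg (fun σ : k ≃+* k => σ c)
    (hAut { Equiv.ofBijective φ hφ with map_mul' := hmul, map_add' := hadd })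

variable {k : Type u} [Field k] {X₀ : Type a} {Y₀ : Type b}

/-- A natural description of the action of the functor `Φ` on the elements of free
representations. -/
structure ElementMaps (Φ : FreeRep k X₀ Y₀ ⥤ FreeRep k X₀ Y₀) where
  /-- The maps of the Lie algebras. -/
  onLie : ∀ W : FreeRep k X₀ Y₀, W.Lie → (Φ.obj W).Lie
  /-- The maps of the modules. -/
  onMod : ∀ W : FreeRep k X₀ Y₀, W.Mod → (Φ.obj W).Mod
  onLie_bijective : ∀ W, Function.Bijective (onLie W)
  onMod_bijective : ∀ W, Function.Bijective (onMod W)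
  map_onLie : ∀ {W U : FreeRep k X₀ Y₀} (f : W ⟶ U) (l : W.Lie),
    (Φ.map f).lie (onLie W l) = onLie U (f.lie l)
  map_onMod : ∀ {W U : FreeRep k X₀ Y₀} (f : W ⟶ U) (x : W.Mod),
    (Φ.map f).mod (onMod W x) = onMod U (f.mod x)
  exists_isLieGen : ∃ A p, IsLieGen A p ∧ IsLieGen (Φ.obj A) (onLie A p)
  exists_isModGen : ∃ B q, IsModGen B q ∧ IsModGen (Φ.obj B) (onMod B q)

namespace ElementMaps

/-- An element of `W` is a morphism from a one-generator object; apply `Φ` to that morphism and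
evaluate at a generator of the image object. -/
theorem nonempty (Φ : FreeRep k X₀ Y₀ ⥤ FreeRep k X₀ Y₀) [Φ.Full] [Φ.Faithful] [Φ.EssSurj]
    [Nonempty X₀] [Nonempty Y₀] : Nonempty (ElementMaps Φ) := by
  obtain ⟨x₀⟩ := id ‹Nonempty X₀›
  obtain ⟨y₀⟩ := id ‹Nonempty Y₀›
  obtain ⟨A, p, hp⟩ : ∃ (A : FreeRep k X₀ Y₀) (p : A.Lie), IsLieGen A p :=
    ⟨_, _, isLieGen_singleton x₀⟩
  obtain ⟨B, q, hq⟩ : ∃ (B : FreeRep k X₀ Y₀) (q : B.Mod), IsModGen B q :=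
    ⟨_, _, isModGen_singleton y₀⟩
  obtain ⟨⟨p', hp'⟩, q', hq'⟩ := exists_isLieGen_and_isModGen_map Φ hp hq
  choose f hf using hp.exists_hom
  choose g hg using hq.exists_hom
  have hfp : f A p = 𝟙 A := hp.hom_ext (hf A p)
  have hgq : g B q = 𝟙 B := hq.hom_ext (hg B q)
  refine ⟨⟨fun W l => (Φ.map (f W l)).lie p', fun W x => (Φ.map (g W x)).mod q',
    fun W => ⟨fun l m h => ?_, fun l => ?_⟩, fun W => ⟨fun l m h => ?_, fun l => ?_⟩,
    fun {W U} h l => ?_, fun {W U} h l => ?_, ⟨A, p, hp, ?_⟩, ⟨B, q, hq, ?_⟩⟩⟩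
  · rw [← hf W l, ← hf W m, Φ.map_injective (hp'.hom_ext h)]
  · obtain ⟨h, hh⟩ := hp'.exists_hom _ l
    obtain ⟨h, rfl⟩ := Φ.map_surjective h
    refine ⟨h.lie p, ?_⟩
    change (Φ.map (f W (h.lie p))).lie p' = l
    rw [← hh, hp.hom_ext (hf W (h.lie p))]
  · rw [← hg W l, ← hg W m, Φ.map_injective (hq'.hom_ext h)]
  · obtain ⟨h, hh⟩ := hq'.exists_hom _ l
    obtain ⟨h, rfl⟩ := Φ.map_surjective h
    refine ⟨h.mod q, ?_⟩
    change (Φ.map (g W (h.mod q))).mod q' = l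
    rw [← hh, hq.hom_ext (hg W (h.mod q))]
  · rw [← comp_lie, ← Φ.map_comp, hp.hom_ext (f := f W l ≫ h) (g := f U (h.lie l))]
    rw [comp_lie, hf, hf]
  · rw [← comp_mod, ← Φ.map_comp, hq.hom_ext (f := g W l ≫ h) (g := g U (h.mod l))]
    rw [comp_mod, hg, hg]
  · rwa [hfp, Φ.map_id]
  · rwa [hgq, Φ.map_id]

variable {Φ : FreeRep k X₀ Y₀ ⥤ FreeRep k X₀ Y₀} (s : ElementMaps Φ)

theorem onLie_zero (W : FreeRep k X₀ Y₀) : s.onLie W 0 = 0 := by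
  let Z : FreeRep k X₀ Y₀ := ⟨∅, ∅⟩
  have : IsEmpty Z.X := ⟨fun z => absurd z.2 (Finset.notMem_empty _)⟩
  obtain ⟨z, hz⟩ := (s.onLie_bijective Z).2 0
  rw [FreeLieAlgebra.eq_zero_of_isEmpty z] at hz
  have h := s.map_onLie (zeroHom Z W) 0
  rw [hz, map_zero, map_zero] at h
  exact h.symm

theorem onMod_zero (W : FreeRep k X₀ Y₀) : s.onMod W 0 = 0 := by
  let Z : FreeRep k X₀ Y₀ := ⟨∅, ∅⟩
  obtain ⟨z, hz⟩ := (s.onMod_bijective Z).2 0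
  have hz₀ : z = 0 := Finsupp.ext fun y => absurd y.2 (Finset.notMem_empty _)
  rw [hz₀] at hz
  have h := s.map_onMod (zeroHom Z W) 0
  rw [hz, map_zero, map_zero] at h
  exact h.symm

/-- On the one-generator object both sides are lines, which defines `φ`; naturality carries it to
every `W`. -/
theorem exists_scalar_onLie : ∃ φ : k → k, Function.Bijective φ ∧
    ∀ (W : FreeRep k X₀ Y₀) (c : k) (l : W.Lie), c • s.onLie W l = s.onLie W (φ c • l) := by
  obtain ⟨A, p, hp, hp'⟩ := s.exists_isLieGen
  obtain ⟨φ, hφ, h⟩ := exists_bijective_scalar hp.ne_zero hp'.ne_zero hp.lie_eq hp'.lie_eq _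
    (s.onLie_bijective A)
  refine ⟨φ, hφ, fun W c l => ?_⟩
  obtain ⟨f, rfl⟩ := hp.exists_hom W l
  rw [← s.map_onLie, ← map_smul, h, s.map_onLie, map_smul]

theorem exists_scalar_onMod : ∃ φ : k → k, Function.Bijective φ ∧
    ∀ (W : FreeRep k X₀ Y₀) (c : k) (x : W.Mod), c • s.onMod W x = s.onMod W (φ c • x) := by
  obtain ⟨B, q, hq, hq'⟩ := s.exists_isModGen
  obtain ⟨φ, hφ, h⟩ := exists_bijective_scalar (k := k) hq.ne_zero hq'.ne_zero hq.mod_eq hq'.mod_eq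
    _ (s.onMod_bijective B)
  refine ⟨φ, hφ, fun W c x => ?_⟩
  obtain ⟨f, rfl⟩ := hq.exists_hom W x
  rw [← s.map_onMod, ← map_smul, h, s.map_onMod, map_smul]

theorem onLie_add [CharZero k] [Nontrivial X₀] (W : FreeRep k X₀ Y₀) (l m : W.Lie) :
    s.onLie W (l + m) = s.onLie W l + s.onLie W m := by
  have hinv : ∀ (W : FreeRep k X₀ Y₀) (l : (Φ.obj W).Lie), ∃ m, s.onLie W m = l := fun W =>
    (s.onLie_bijective W).2
  choose inv hinv using hinv
  obtain ⟨φ, hφ, hφs⟩ := s.exists_scalar_onLie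
  -- Doubling before `s` is multiplication by `t` after `s`, so the pulled back sum is homogeneous
  -- of degree one although `s` is not yet known to be linear.
  obtain ⟨t, ht⟩ := hφ.2 2
  obtain ⟨c, d, hcd⟩ := natural_lie_op_degree_one
    (fun W l m => inv W (s.onLie W l + s.onLie W m))
    (fun W U f l m => (s.onLie_bijective U).1 (by
      rw [← s.map_onLie, hinv, hinv, map_add, s.map_onLie, s.map_onLie]))
    (fun W l m => (s.onLie_bijective W).1 (by
      rw [hinv, ← ht, ← hφs, ← hφs, ← hφs, hinv, smul_add]))
  have hcd' : ∀ (W : FreeRep k X₀ Y₀) (l m : W.Lie),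
      s.onLie W l + s.onLie W m = s.onLie W (c • l + d • m) := fun W l m => by
    rw [← hcd, hinv]
  obtain ⟨A, p, hp, -⟩ := s.exists_isLieGen
  -- Zero is still neutral for the pulled back addition, which fixes both coefficients.
  have hc : c = 1 := by
    refine smul_left_injective k hp.ne_zero ((s.onLie_bijective A).1 ?_)
    have h := hcd' A p 0
    rw [s.onLie_zero, add_zero, smul_zero, add_zero] at h
    simp only [one_smul, h]
  have hd : d = 1 := by
    refine smul_left_injective k hp.ne_zero ((s.onLie_bijective A).1 ?_)
    have h := hcd' A 0 p
    rw [s.onLie_zero, zero_add, smul_zero, zero_add] at h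
    simp only [one_smul, h]
  rw [hcd', hc, hd, one_smul, one_smul]

theorem onMod_add [Nontrivial Y₀] (W : FreeRep k X₀ Y₀) (x y : W.Mod) :
    s.onMod W (x + y) = s.onMod W x + s.onMod W y := by
  have hinv : ∀ (W : FreeRep k X₀ Y₀) (l : (Φ.obj W).Mod), ∃ m, s.onMod W m = l := fun W =>
    (s.onMod_bijective W).2
  choose inv hinv using hinv
  obtain ⟨c, d, hcd⟩ := natural_mod_op
    (fun W l m => inv W (s.onMod W l + s.onMod W m))
    (fun W U f l m => (s.onMod_bijective U).1 (by
      rw [← s.map_onMod, hinv, hinv, map_add, s.map_onMod, s.map_onMod]))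
  have hcd' : ∀ (W : FreeRep k X₀ Y₀) (l m : W.Mod),
      s.onMod W l + s.onMod W m = s.onMod W (c • l + d • m) := fun W l m => by
    rw [← hcd, hinv]
  obtain ⟨B, q, hq, -⟩ := s.exists_isModGen
  have hc : c = 1 := by
    refine smul_left_injective k hq.ne_zero ((s.onMod_bijective B).1 ?_)
    have h := hcd' B q 0
    rw [s.onMod_zero, add_zero, smul_zero, add_zero] at h
    simp only [one_smul, h]
  have hd : d = 1 := by
    refine smul_left_injective k hq.ne_zero ((s.onMod_bijective B).1 ?_)
    have h := hcd' B 0 q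
    rw [s.onMod_zero, zero_add, smul_zero, zero_add] at h
    simp only [one_smul, h]
  rw [hcd', hc, hd, one_smul, one_smul]

/-- Additivity of `s` makes the scalar bijection `φ` a field automorphism, hence the identity. -/
theorem onLie_smul [CharZero k] [Nontrivial X₀] (hAut : ∀ σ : k ≃+* k, σ = RingEquiv.refl k)
    (W : FreeRep k X₀ Y₀) (c : k) (l : W.Lie) : s.onLie W (c • l) = c • s.onLie W l := by
  obtain ⟨φ, hφ, hφs⟩ := s.exists_scalar_onLie
  obtain ⟨A, p, hp, -⟩ := s.exists_isLieGen
  rw [hφs, eq_id_of_forall_ringEquiv hAut hφ (fun c d => ?_) (fun c d => ?_) c]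
  · refine smul_left_injective k hp.ne_zero ((s.onLie_bijective A).1 ?_)
    change s.onLie A (φ (c * d) • p) = s.onLie A ((φ c * φ d) • p)
    rw [← hφs, mul_smul, mul_smul, hφs, hφs]
  · refine smul_left_injective k hp.ne_zero ((s.onLie_bijective A).1 ?_)
    change s.onLie A (φ (c + d) • p) = s.onLie A ((φ c + φ d) • p)
    rw [← hφs, add_smul, add_smul, hφs, hφs, s.onLie_add]

theorem onMod_smul [Nontrivial Y₀] (hAut : ∀ σ : k ≃+* k, σ = RingEquiv.refl k)
    (W : FreeRep k X₀ Y₀) (c : k) (x : W.Mod) : s.onMod W (c • x) = c • s.onMod W x := by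
  obtain ⟨φ, hφ, hφs⟩ := s.exists_scalar_onMod
  obtain ⟨B, q, hq, -⟩ := s.exists_isModGen
  rw [hφs, eq_id_of_forall_ringEquiv hAut hφ (fun c d => ?_) (fun c d => ?_) c]
  · refine smul_left_injective k hq.ne_zero ((s.onMod_bijective B).1 ?_)
    change s.onMod B (φ (c * d) • q) = s.onMod B ((φ c * φ d) • q)
    rw [← hφs, mul_smul, mul_smul, hφs, hφs]
  · refine smul_left_injective k hq.ne_zero ((s.onMod_bijective B).1 ?_)
    change s.onMod B (φ (c + d) • q) = s.onMod B ((φ c + φ d) • q)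
    rw [← hφs, add_smul, add_smul, hφs, hφs, s.onMod_add]

section Bracket

variable [CharZero k]

theorem exists_onLie_lie (hAut : ∀ σ : k ≃+* k, σ = RingEquiv.refl k) [Nontrivial X₀] :
    ∃ c : k, ∀ (W : FreeRep k X₀ Y₀) (l m : W.Lie),
      ⁅s.onLie W l, s.onLie W m⁆ = s.onLie W (c • ⁅l, m⁆) := by
  have hinv : ∀ (W : FreeRep k X₀ Y₀) (l : (Φ.obj W).Lie), ∃ m, s.onLie W m = l := fun W =>
    (s.onLie_bijective W).2
  choose inv hinv using hinv
  obtain ⟨c, hc⟩ := natural_lie_op_degree_two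
    (fun W l m => inv W ⁅s.onLie W l, s.onLie W m⁆)
    (fun W U f l m => (s.onLie_bijective U).1 (by
      rw [← s.map_onLie, hinv, hinv, LieHom.map_lie, s.map_onLie, s.map_onLie]))
    (fun W l m => (s.onLie_bijective W).1 (by
      rw [hinv, s.onLie_smul hAut, s.onLie_smul hAut, s.onLie_smul hAut, hinv, smul_lie, lie_smul,
        smul_smul, pow_two]))
  exact ⟨c, fun W l m => by rw [← hc, hinv]⟩

theorem exists_onMod_lie (hAut : ∀ σ : k ≃+* k, σ = RingEquiv.refl k) [Nontrivial X₀]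
    [Nontrivial Y₀] :
    ∃ c : k, ∀ (W : FreeRep k X₀ Y₀) (l : W.Lie) (x : W.Mod),
      ⁅s.onLie W l, s.onMod W x⁆ = s.onMod W (c • ⁅l, x⁆) := by
  have hinv : ∀ (W : FreeRep k X₀ Y₀) (l : (Φ.obj W).Mod), ∃ m, s.onMod W m = l := fun W =>
    (s.onMod_bijective W).2
  choose inv hinv using hinv
  obtain ⟨c, hc⟩ := natural_act_op_degree_one
    (fun W l x => inv W ⁅s.onLie W l, s.onMod W x⁆)
    (fun W U f l x => (s.onMod_bijective U).1 (by
      rw [← s.map_onMod, hinv, hinv, ← LieRepHom.map_act, s.map_onLie, s.map_onMod]))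
    (fun W l x => (s.onMod_bijective W).1 (by
      rw [hinv, s.onLie_smul hAut, s.onMod_smul hAut, hinv, smul_lie]))
  exact ⟨c, fun W l x => by rw [← hc, hinv]⟩

/-- The bracket and the action are changed by the same non-zero factor. -/
theorem exists_factor (hAut : ∀ σ : k ≃+* k, σ = RingEquiv.refl k)
    [Nontrivial X₀] [Nontrivial Y₀] (hΦ : Function.Surjective Φ.obj) :
    ∃ c : k, c ≠ 0 ∧
      (∀ (W : FreeRep k X₀ Y₀) (l m : W.Lie),
        ⁅s.onLie W l, s.onLie W m⁆ = c • s.onLie W ⁅l, m⁆) ∧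
      ∀ (W : FreeRep k X₀ Y₀) (l : W.Lie) (x : W.Mod),
        ⁅s.onLie W l, s.onMod W x⁆ = c • s.onMod W ⁅l, x⁆ := by
  classical
  obtain ⟨d, hd⟩ := s.exists_onLie_lie hAut
  obtain ⟨c, hc⟩ := s.exists_onMod_lie hAut
  simp only [s.onLie_smul hAut] at hd
  simp only [s.onMod_smul hAut] at hc
  obtain ⟨x₁, x₂, hx⟩ := exists_pair_ne X₀
  obtain ⟨y₀⟩ : Nonempty Y₀ := inferInstance
  let P : FreeRep k X₀ Y₀ := ⟨{x₁, x₂}, {y₀}⟩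
  let z₁ : P.X := ⟨x₁, by simp [P]⟩
  let z₂ : P.X := ⟨x₂, by simp [P]⟩
  let y : P.Y := ⟨y₀, Finset.mem_singleton_self y₀⟩
  have hz : z₁ ≠ z₂ := fun h => hx (congrArg Subtype.val h)
  have hne : ⁅⁅P.ofLie z₁, P.ofLie z₂⁆, P.ofMod y⁆ ≠ 0 := by
    rw [FreeActModule.lie_def, freeLieToFreeAssoc_lie, ofLie, ofLie, freeLieToFreeAssoc_of,
      freeLieToFreeAssoc_of, ofMod, Finsupp.smul_single, smul_eq_mul, mul_one, Ne,
      Finsupp.single_eq_zero, sub_eq_zero]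
    exact FreeAlgebra.ι_mul_ι_ne hz
  -- If `c = 0`, every object in the image of `Φ` has zero action, but `P` is such an object and
  -- acts non-trivially.
  have hc₀ : c ≠ 0 := by
    rintro rfl
    have hact : ∀ (W : FreeRep k X₀ Y₀) (l : (Φ.obj W).Lie) (x : (Φ.obj W).Mod), ⁅l, x⁆ = 0 := by
      intro W l x
      obtain ⟨l, rfl⟩ := (s.onLie_bijective W).2 l
      obtain ⟨x, rfl⟩ := (s.onMod_bijective W).2 x
      rw [hc, zero_smul]
    obtain ⟨W, hW⟩ := hΦ P
    have := hact W
    rw [hW] at this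
    exact hne (this _ _)
  -- In the Leibniz identity two nested actions contribute `c * c`, while a bracket followed by an
  -- action contributes `d * c`.
  have hdc : d = c := by
    have h := leibniz_lie (s.onLie P (P.ofLie z₁)) (s.onLie P (P.ofLie z₂)) (s.onMod P (P.ofMod y))
    have h' := leibniz_lie (P.ofLie z₁) (P.ofLie z₂) (P.ofMod y)
    have h₁ : ⁅s.onLie P (P.ofLie z₁), ⁅s.onLie P (P.ofLie z₂), s.onMod P (P.ofMod y)⁆⁆ =
        (c * c) • s.onMod P ⁅P.ofLie z₁, ⁅P.ofLie z₂, P.ofMod y⁆⁆ := by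
      rw [hc, lie_smul c (s.onLie P (P.ofLie z₁)), hc, smul_smul]
    have h₂ : ⁅s.onLie P (P.ofLie z₂), ⁅s.onLie P (P.ofLie z₁), s.onMod P (P.ofMod y)⁆⁆ =
        (c * c) • s.onMod P ⁅P.ofLie z₂, ⁅P.ofLie z₁, P.ofMod y⁆⁆ := by
      rw [hc, lie_smul c (s.onLie P (P.ofLie z₂)), hc, smul_smul]
    have h₃ : ⁅⁅s.onLie P (P.ofLie z₁), s.onLie P (P.ofLie z₂)⁆, s.onMod P (P.ofMod y)⁆ =
        (d * c) • s.onMod P ⁅⁅P.ofLie z₁, P.ofLie z₂⁆, P.ofMod y⁆ := by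
      rw [hd, smul_lie, hc, smul_smul]
    rw [h₁, h₂, h₃, h', s.onMod_add, smul_add] at h
    have h₄ := add_right_cancel h
    have hne' : s.onMod P ⁅⁅P.ofLie z₁, P.ofLie z₂⁆, P.ofMod y⁆ ≠ 0 := fun h =>
      hne ((s.onMod_bijective P).1 (h.trans (s.onMod_zero P).symm))
    exact (mul_right_cancel₀ hc₀ (smul_left_injective k hne' h₄)).symm
  subst hdc
  exact ⟨d, hc₀, hd, hc⟩

/-- An automorphism of the category of free representations acts on the elements as an
isomorphism of representations, up to a scalar factor on the Lie algebras. -/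
theorem exists_lieRepHom (hAut : ∀ σ : k ≃+* k, σ = RingEquiv.refl k)
    [Nontrivial X₀] [Nontrivial Y₀] (hΦ : Function.Surjective Φ.obj) :
    ∃ c : k, c ≠ 0 ∧ ∀ W : FreeRep k X₀ Y₀, ∃ F : W ⟶ Φ.obj W,
      (∀ l, F.lie l = c • s.onLie W l) ∧ ∀ x, F.mod x = s.onMod W x := by
  obtain ⟨c, hc, hL, hM⟩ := s.exists_factor hAut hΦ
  refine ⟨c⁻¹, inv_ne_zero hc, fun W => ⟨⟨{
    toFun := fun l => c⁻¹ • s.onLie W l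
    map_add' := fun l m => by rw [s.onLie_add, smul_add]
    map_smul' := fun t l => by rw [s.onLie_smul hAut, smul_comm, RingHom.id_apply]
    map_lie' := fun {l m} => by
      rw [smul_lie, lie_smul, hL, smul_smul c⁻¹ c, inv_mul_cancel₀ hc, one_smul] }, {
    toFun := s.onMod W
    map_add' := s.onMod_add W
    map_smul' := s.onMod_smul hAut W }, fun l x => ?_⟩, fun _ => rfl, fun _ => rfl⟩⟩
  change ⁅c⁻¹ • s.onLie W l, s.onMod W x⁆ = s.onMod W ⁅l, x⁆
  rw [smul_lie, hM, smul_smul, inv_mul_cancel₀ hc, one_smul]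

end Bracket

end ElementMaps

end FreeRep

/-! ### Closed systems and inverse images. -/

section ClosedSystems

variable {k : Type u} [CommRing k] {X₀ : Type a} {Y₀ : Type b} {W U : FreeRep k X₀ Y₀}
  {L : Type v} {V : Type w} [LieRing L] [LieAlgebra k L] [AddCommGroup V] [Module k V]
  [LieRingModule L V] [LieModule k L V]

theorem le_algClosure (T : EqSystem W) : T ≤ algClosure L V T :=
  ⟨fun t ht _ hf => hf.1 t ht, fun t ht _ hf => hf.2 t ht⟩

theorem algClosure_mono {S T : EqSystem W} (h : S ≤ T) : algClosure L V S ≤ algClosure L V T :=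
  ⟨fun _ ht f hf => ht f ⟨fun s hs => hf.1 s (h.1 hs), fun s hs => hf.2 s (h.2 hs)⟩,
    fun _ ht f hf => ht f ⟨fun s hs => hf.1 s (h.1 hs), fun s hs => hf.2 s (h.2 hs)⟩⟩

theorem algClosure_mem_closedSystems (T : EqSystem W) : algClosure L V T ∈ closedSystems W L V :=
  le_antisymm
    (Prod.le_def.2 ⟨fun _ ht f hf => ht f ⟨fun _ hs => hs f hf, fun _ hs => hs f hf⟩,
      fun _ ht f hf => ht f ⟨fun _ hs => hs f hf, fun _ hs => hs f hf⟩⟩)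
    (le_algClosure _)

theorem algClosure_le_of_mem {S T : EqSystem W} (h : S ≤ T) (hT : T ∈ closedSystems W L V) :
    algClosure L V S ≤ T :=
  (algClosure_mono h).trans (le_of_eq hT)

/-- The closure of `T` is the least closed system containing `T`. -/
theorem algClosure_eq_of_closedSystems_eq {L' : Type v'} {V' : Type w'} [LieRing L']
    [LieAlgebra k L'] [AddCommGroup V'] [Module k V'] [LieRingModule L' V'] [LieModule k L' V']
    (h : ∀ T : EqSystem W, T ∈ closedSystems W L V ↔ T ∈ closedSystems W L' V') (T : EqSystem W) :
    algClosure L V T = algClosure L' V' T :=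
  le_antisymm
    (algClosure_le_of_mem (le_algClosure T) ((h _).2 (algClosure_mem_closedSystems T)))
    (algClosure_le_of_mem (le_algClosure T) ((h _).1 (algClosure_mem_closedSystems T)))

theorem zero_mem_fst_of_closed {T : EqSystem W} (hT : T ∈ closedSystems W L V) : 0 ∈ T.1 := by
  rw [← show algClosure L V T = T from hT]
  exact fun f _ => map_zero f.lie

theorem zero_mem_snd_of_closed {T : EqSystem W} (hT : T ∈ closedSystems W L V) : 0 ∈ T.2 := by
  rw [← show algClosure L V T = T from hT]
  exact fun f _ => map_zero f.mod

theorem smul_mem_fst_of_closed {T : EqSystem W} (hT : T ∈ closedSystems W L V) (c : k) {l : W.Lie}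
    (hl : l ∈ T.1) : c • l ∈ T.1 := by
  rw [← show algClosure L V T = T from hT] at hl ⊢
  exact fun f hf => by rw [map_smul, hl f hf, smul_zero]

theorem smul_mem_snd_of_closed {T : EqSystem W} (hT : T ∈ closedSystems W L V) (c : k) {x : W.Mod}
    (hx : x ∈ T.2) : c • x ∈ T.2 := by
  rw [← show algClosure L V T = T from hT] at hx ⊢
  exact fun f hf => by rw [map_smul, hx f hf, smul_zero]

/-- The inverse image of a system of equations. -/
def EqSystem.comap (F : W ⟶ U) (T : EqSystem U) : EqSystem W :=
  (F.lie ⁻¹' T.1, F.mod ⁻¹' T.2)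

theorem EqSystem.comap_mem_closedSystems (F : W ⟶ U) {T : EqSystem U}
    (hT : T ∈ closedSystems U L V) : T.comap F ∈ closedSystems W L V := by
  have hsol : ∀ f ∈ solutions L V T, (⟨f.lie.comp F.lie, f.mod ∘ₗ F.mod, fun l x => by
      change ⁅f.lie (F.lie l), f.mod (F.mod x)⁆ = f.mod (F.mod ⁅l, x⁆)
      rw [f.map_act, F.map_act]⟩ : LieRepHom k W.Lie W.Mod L V) ∈ solutions L V (T.comap F) :=
    fun f hf => ⟨fun t ht => hf.1 _ ht, fun t ht => hf.2 _ ht⟩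
  refine le_antisymm (Prod.le_def.2 ⟨fun t ht => ?_, fun t ht => ?_⟩) (le_algClosure _)
  · change F.lie t ∈ T.1
    rw [← show algClosure L V T = T from hT]
    exact fun f hf => ht _ (hsol f hf)
  · change F.mod t ∈ T.2
    rw [← show algClosure L V T = T from hT]
    exact fun f hf => ht _ (hsol f hf)

theorem FreeRep.exists_inverse (F : W ⟶ U) (hl : Function.Bijective F.lie)
    (hm : Function.Bijective F.mod) :
    ∃ G : U ⟶ W, (∀ l, G.lie (F.lie l) = l) ∧ ∀ x, G.mod (F.mod x) = x := by
  let e := LieEquiv.ofBijective F.lie hl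
  let e' := LinearEquiv.ofBijective F.mod hm
  have he : ∀ l, e.symm (F.lie l) = l := e.symm_apply_apply
  have he' : ∀ x, e'.symm (F.mod x) = x := e'.symm_apply_apply
  refine ⟨⟨e.symm.toLieHom, e'.symm.toLinearMap, fun l x => ?_⟩, he, he'⟩
  obtain ⟨l, rfl⟩ := hl.2 l
  obtain ⟨x, rfl⟩ := hm.2 x
  change ⁅e.symm (F.lie l), e'.symm (F.mod x)⁆ = e'.symm ⁅F.lie l, F.mod x⁆
  rw [he, he', F.map_act, he']

end ClosedSystems

/-! ### Closed systems read off from congruences. -/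

section Equivalence

variable {k : Type u} [Field k] {X₀ : Type a} {Y₀ : Type b}
  {L : Type v} {V : Type w} [LieRing L] [LieAlgebra k L] [AddCommGroup V] [Module k V]
  [LieRingModule L V] [LieModule k L V]

theorem FreeRep.IsLieGen.mem_congrRel_iff {A W : FreeRep k X₀ Y₀} {p : A.Lie} (hp : A.IsLieGen p)
    {T : EqSystem W} (hT : T ∈ closedSystems W L V) (f g : A ⟶ W) :
    (f, g) ∈ congrRel A W T ↔ f.lie p - g.lie p ∈ T.1 := by
  refine ⟨fun h => h.1 p, fun h => ⟨fun l => ?_, fun x => ?_⟩⟩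
  · obtain ⟨c, rfl⟩ := hp.lie_eq l
    rw [map_smul, map_smul, ← smul_sub]
    exact smul_mem_fst_of_closed hT c h
  · rw [hp.mod_eq x, map_zero, map_zero, sub_zero]
    exact zero_mem_snd_of_closed hT

theorem FreeRep.IsModGen.mem_congrRel_iff {B W : FreeRep k X₀ Y₀} {q : B.Mod} (hq : B.IsModGen q)
    {T : EqSystem W} (hT : T ∈ closedSystems W L V) (f g : B ⟶ W) :
    (f, g) ∈ congrRel B W T ↔ f.mod q - g.mod q ∈ T.2 := by
  refine ⟨fun h => h.2 q, fun h => ⟨fun l => ?_, fun x => ?_⟩⟩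
  · rw [hq.lie_eq l, map_zero, map_zero, sub_zero]
    exact zero_mem_fst_of_closed hT
  · obtain ⟨c, rfl⟩ := hq.mod_eq x
    rw [map_smul, map_smul, ← smul_sub c (f.mod q)]
    exact smul_mem_snd_of_closed hT c h

variable {L' : Type v'} {V' : Type w'} [LieRing L'] [LieAlgebra k L'] [AddCommGroup V']
  [Module k V'] [LieRingModule L' V'] [LieModule k L' V']
  {Φ : FreeRep k X₀ Y₀ ⥤ FreeRep k X₀ Y₀} [Φ.Faithful] (s : FreeRep.ElementMaps Φ)
  {W : FreeRep k X₀ Y₀} {T : EqSystem W} {T' : EqSystem (Φ.obj W)}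

theorem FreeRep.mem_congrRel_map_iff {A : FreeRep k X₀ Y₀}
    (h : (fun p : (A ⟶ W) × (A ⟶ W) => (Φ.map p.1, Φ.map p.2)) '' congrRel A W T =
      congrRel (Φ.obj A) (Φ.obj W) T') (f g : A ⟶ W) :
    (f, g) ∈ congrRel A W T ↔ (Φ.map f, Φ.map g) ∈ congrRel (Φ.obj A) (Φ.obj W) T' := by
  rw [← h]
  refine ⟨fun hfg => ⟨_, hfg, rfl⟩, ?_⟩
  rintro ⟨⟨f', g'⟩, hfg, he⟩
  rw [← Φ.map_injective (congrArg Prod.fst he), ← Φ.map_injective (congrArg Prod.snd he)]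
  exact hfg

/-- An element lies in a closed system exactly when the morphism from the one-generator object that
it defines is congruent to the zero morphism, and `h` transports this congruence along `Φ`. -/
theorem FreeRep.ElementMaps.onLie_mem_iff (hT : T ∈ closedSystems W L V)
    (hT' : T' ∈ closedSystems (Φ.obj W) L' V')
    (h : ∀ A, (fun p : (A ⟶ W) × (A ⟶ W) => (Φ.map p.1, Φ.map p.2)) '' congrRel A W T =
      congrRel (Φ.obj A) (Φ.obj W) T') (l : W.Lie) : s.onLie W l ∈ T'.1 ↔ l ∈ T.1 := by
  obtain ⟨A, p, hp, hp'⟩ := s.exists_isLieGen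
  obtain ⟨f, rfl⟩ := hp.exists_hom W l
  have key := FreeRep.mem_congrRel_map_iff (h A) f (FreeRep.zeroHom A W)
  rw [hp.mem_congrRel_iff hT, hp'.mem_congrRel_iff hT', s.map_onLie, s.map_onLie,
    FreeRep.zeroHom_lie, s.onLie_zero, sub_zero, sub_zero] at key
  exact key.symm

theorem FreeRep.ElementMaps.onMod_mem_iff (hT : T ∈ closedSystems W L V)
    (hT' : T' ∈ closedSystems (Φ.obj W) L' V')
    (h : ∀ A, (fun p : (A ⟶ W) × (A ⟶ W) => (Φ.map p.1, Φ.map p.2)) '' congrRel A W T =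
      congrRel (Φ.obj A) (Φ.obj W) T') (x : W.Mod) : s.onMod W x ∈ T'.2 ↔ x ∈ T.2 := by
  obtain ⟨B, q, hq, hq'⟩ := s.exists_isModGen
  obtain ⟨f, rfl⟩ := hq.exists_hom W x
  have key := FreeRep.mem_congrRel_map_iff (h B) f (FreeRep.zeroHom B W)
  rw [hq.mem_congrRel_iff hT, hq'.mem_congrRel_iff hT', s.map_onMod, s.map_onMod,
    FreeRep.zeroHom_mod, s.onMod_zero, sub_zero, sub_zero] at key
  exact key.symm

end Equivalence

theorem IsCategoryAut.isEquivalence {C : Type a} [Category.{b} C] {Φ : C ⥤ C}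
    (h : IsCategoryAut Φ) : Φ.IsEquivalence := by
  obtain ⟨Ψ, h₁, h₂⟩ := h
  exact Functor.IsEquivalence.mk' Ψ (eqToIso h₁.symm) (eqToIso h₂)

theorem IsCategoryAut.obj_surjective {C : Type a} [Category.{b} C] {Φ : C ⥤ C}
    (h : IsCategoryAut Φ) : Function.Surjective Φ.obj := by
  obtain ⟨Ψ, -, h₂⟩ := h
  exact fun U => ⟨Ψ.obj U, Functor.congr_obj h₂ U⟩

/-! ### The two implications. -/

section Main

variable {k : Type u} [Field k] {X₀ : Type a} {Y₀ : Type b}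
  {L : Type v} {V : Type w} [LieRing L] [LieAlgebra k L] [AddCommGroup V] [Module k V]
  [LieRingModule L V] [LieModule k L V]
  {L' : Type v'} {V' : Type w'} [LieRing L'] [LieAlgebra k L'] [AddCommGroup V'] [Module k V']
  [LieRingModule L' V'] [LieModule k L' V']

theorem GeometricallyEquivalent.automorphicallyEquivalent
    (h : GeometricallyEquivalent k X₀ Y₀ L V L' V') :
    AutomorphicallyEquivalent k X₀ Y₀ L V L' V' := by
  refine ⟨𝟭 _, ⟨𝟭 _, rfl, rfl⟩, fun W T => ⟨T.1, (h W T.1).symm.trans T.2⟩, fun W => ⟨?_, ?_⟩,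
    fun W₁ W₂ T => Set.image_id' _⟩
  · exact fun S T hST => Subtype.ext (congrArg (fun R => R.1) hST)
  · exact fun T => ⟨⟨T.1, (h W T.1).trans T.2⟩, rfl⟩

theorem AutomorphicallyEquivalent.geometricallyEquivalent [CharZero k]
    (hAut : ∀ σ : k ≃+* k, σ = RingEquiv.refl k) [Nontrivial X₀] [Nontrivial Y₀]
    (h : AutomorphicallyEquivalent k X₀ Y₀ L V L' V') :
    GeometricallyEquivalent k X₀ Y₀ L V L' V' := by
  obtain ⟨Φ, hΦ, α, hα, hcongr⟩ := h
  have := hΦ.isEquivalence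
  obtain ⟨s⟩ := FreeRep.ElementMaps.nonempty Φ
  obtain ⟨c, hc, hF⟩ := s.exists_lieRepHom hAut hΦ.obj_surjective
  intro W
  obtain ⟨F, hFl, hFm⟩ := hF W
  have hbl : Function.Bijective F.lie := by
    have : ⇑F.lie = (fun l => c • l) ∘ s.onLie W := funext hFl
    rw [this]
    exact (MulAction.bijective₀ hc).comp (s.onLie_bijective W)
  have hbm : Function.Bijective F.mod := by
    have : ⇑F.mod = s.onMod W := funext hFm
    rw [this]
    exact s.onMod_bijective W
  obtain ⟨G, hGl, hGm⟩ := FreeRep.exists_inverse F hbl hbm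
  -- The factor `c` between `F` and `s` is harmless, since closed systems are stable under scalars.
  have hcomap : ∀ T : closedSystems W L V, EqSystem.comap F (α W T).1 = T.1 := by
    intro T
    have hT' := (α W T).2
    refine Prod.ext (Set.ext fun l => ?_) (Set.ext fun x => ?_)
    · change F.lie l ∈ (α W T).1.1 ↔ _
      rw [← s.onLie_mem_iff T.2 hT' (fun A => hcongr A W T), hFl]
      refine ⟨fun h => ?_, smul_mem_fst_of_closed hT' c⟩
      have := smul_mem_fst_of_closed hT' c⁻¹ h
      rwa [smul_smul, inv_mul_cancel₀ hc, one_smul] at this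
    · change F.mod x ∈ (α W T).1.2 ↔ _
      rw [← s.onMod_mem_iff T.2 hT' (fun A => hcongr A W T), hFm]
  refine algClosure_eq_of_closedSystems_eq fun T => ⟨fun hT => ?_, fun hT => ?_⟩
  · rw [← show _ = T from hcomap ⟨T, hT⟩]
    exact EqSystem.comap_mem_closedSystems F (α W ⟨T, hT⟩).2
  -- Surjectivity of `α W` realizes the transport of `T` to `Φ.obj W`; pulling it back along `F`
  -- recovers `T` as the closed system `S`.
  · obtain ⟨S, hS⟩ := (hα W).2 ⟨T.comap G, EqSystem.comap_mem_closedSystems G hT⟩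
    have hST : S.1 = T := by
      rw [← hcomap S, hS]
      refine Prod.ext (Set.ext fun l => ?_) (Set.ext fun x => ?_)
      · change G.lie (F.lie l) ∈ T.1 ↔ _
        rw [hGl]
      · change G.mod (F.mod x) ∈ T.2 ↔ _
        rw [hGm]
    exact hST ▸ S.2

end Main

theorem mainTheorem1 {k : Type*} [Field k] [CharZero k]
    (hAut : ∀ σ : k ≃+* k, σ = RingEquiv.refl k)
    (X₀ Y₀ : Type*) [Countable X₀] [Infinite X₀] [Countable Y₀] [Infinite Y₀]
    (L₁ V₁ : Type*) [LieRing L₁] [LieAlgebra k L₁] [AddCommGroup V₁] [Module k V₁]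
    [LieRingModule L₁ V₁] [LieModule k L₁ V₁]
    (L₂ V₂ : Type*) [LieRing L₂] [LieAlgebra k L₂] [AddCommGroup V₂] [Module k V₂]
    [LieRingModule L₂ V₂] [LieModule k L₂ V₂] :
    AutomorphicallyEquivalent k X₀ Y₀ L₁ V₁ L₂ V₂ ↔
      GeometricallyEquivalent k X₀ Y₀ L₁ V₁ L₂ V₂ :=
  ⟨fun h => h.geometricallyEquivalent hAut, fun h => h.automorphicallyEquivalent⟩
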